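/- Let $\mathbb{A}=(a_{ij})_{i,j\in I}$ be a symmetrizable generalized Cartan matrix with finite index set $I$, and let $\mathcal{D}=(I,\mathbb{A},\Lambda,(\alpha_i)_{i\in I},(\alpha_i^\vee)_{i\in I})$ be a free and cofree Kac–Moody root datum: $\Lambda$ is a free $\mathbb{Z}$-module of finite rank, the $\alpha_i\in\Lambda$ are linearly independent, the $\alpha_i^\vee\in\Lambda^\vee=\operatorname{Hom}(\Lambda,\mathbb{Z})$ are linearly independent, and $\langle\alpha_j,\alpha_i^\vee\rangle=a_{ij}$ for all $i,j\in I$. Put $\mathfrak{a}=\Lambda^\vee\otimes_{\mathbb{Z}}\mathbb{R}$. Let $W$ be the Weyl group of $\mathbb{A}$, i.e. the Coxeter group with generators $s_i$ $(i\in I)$ and relations $(s_is_j)^{m_{ij}}=1$, where $m_{ii}=1$ and, for $i\ne j$, $m_{ij}=2,3,4,6,\infty$ according to $a_{ij}a_{ji}=0,1,2,3,\ge 4$; it acts linearly on $\mathfrak{a}$ by $s_i(x)=x-\langle\alpha_i,x\rangle\alpha_i^\vee$. Extend $(\alpha_i^\vee)_{i\in I}$ to an $\mathbb{R}$-basis of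 $\mathfrak{a}$ and let $\omega_i\in\mathfrak{a}^*$ $(i\in I)$ be the element of the dual basis corresponding to $\alpha_i^\vee$. Let $h\in\mathfrak{a}$ satisfy $\langle\alpha_k,h\rangle>0$ for all $k\in I$, and set $\Xi_h=\operatorname{conv}(W\cdot h)$ and $E_h=h+\sum_{k\in I}\mathbb{R}\alpha_k^\vee$. Fix $i\in I$ and $t\in\mathbb{R}$, and put $$H^{(i)}(t)=\{y\in E_h:\langle\omega_i,y\rangle=t\},\qquad P^{(i)}(t)=\Xi_h\cap H^{(i)}(t).$$ Let $W^{(i)}\subset W$ be the subgroup generated by the $s_k$ with $k\in I\setminus\{i\}$, and let $C^{(i)}=\{y\in\mathfrak{a}:\langle\alpha_k,y\rangle>0\text{ for all }k\in I\setminus\{i\}\}$. A face of a convex set $P$ is a non-empty convex subset $F\subset P$ such that $p_1,p_2\in F$ whenever $p_1,p_2\in P$ and the open segment $(p_1,p_2)$ meets $F$. Let the essential part $P^{(i)}_{\mathrm{ess}}(t)$ be the union of all faces of $P^{(i)}(t)$ that are contained in $C^{(i)}$. Then every point of $P^{(i)}(t)$ lies in the convex hull of the $W^{(i)}$-orbit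 of a point of $P^{(i)}_{\mathrm{ess}}(t)$; more precisely, $$P^{(i)}(t)=\bigcup_{y\in P^{(i)}_{\mathrm{ess}}(t)}\operatorname{conv}\bigl(W^{(i)}\cdot y\bigr).$$ -/

import Mathlib

open scoped TensorProduct

/-- A generalized Cartan matrix. -/
structure IsGCM {ι : Type*} (A : Matrix ι ι ℤ) : Prop where
  diag : ∀ i, A i i = 2
  off_diag : ∀ i j, i ≠ j → A i j ≤ 0
  zero_iff : ∀ i j, A i j = 0 ↔ A j i = 0

/-- `A` is symmetrizable if it is the product of a diagonal matrix and a symmetric matrix. -/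
def IsSymmetrizable {ι : Type*} [Fintype ι] [DecidableEq ι] (A : Matrix ι ι ℤ) : Prop :=
  ∃ (d : ι → ℝ) (B : Matrix ι ι ℝ), B.IsSymm ∧
    A.map (fun z : ℤ => (z : ℝ)) = Matrix.diagonal d * B

/-- A Kac-Moody root datum with index set `ι` and lattice `Λ`: a generalized Cartan matrix `A`, a
family `c i` in `Λ` and a family `d i` in the dual of `Λ` with `⟨c j, d i⟩ = A i j`. -/
structure KacMoodyRootDatum (ι Λ : Type*) [AddCommGroup Λ] where
  A : Matrix ι ι ℤ
  isGCM : IsGCM A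
  c : ι → Λ
  d : ι → Module.Dual ℤ Λ
  pairing : ∀ i j, d i (c j) = A i j

/-- The real Cartan subalgebra, i.e. the dual lattice of `Λ` with scalars extended to `ℝ`. -/
abbrev RealCartan (Λ : Type*) [AddCommGroup Λ] : Type _ := ℝ ⊗[ℤ] Module.Dual ℤ Λ

/-- The order `m_ij` of a product of two distinct simple reflections as a function of
`a_ij * a_ji`; the value `0` stands for an infinite order. -/
def coxeterOrder (z : ℤ) : ℕ :=
  if z = 0 then 2 else if z = 1 then 3 else if z = 2 then 4 else if z = 3 then 6 else 0

namespace KacMoodyRootDatum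

variable {ι Λ : Type*} [AddCommGroup Λ] (D : KacMoodyRootDatum ι Λ)

/-- The root datum is free if the elements `c i` of `Λ` are linearly independent. -/
def IsFree : Prop := LinearIndependent ℤ D.c

/-- The root datum is cofree if the elements `d i` of the dual of `Λ` are linearly independent. -/
def IsCofree : Prop := LinearIndependent ℤ D.d

/-- The simple root `α_i` as a linear functional on the real Cartan subalgebra. -/
noncomputable def root (i : ι) : Module.Dual ℝ (RealCartan Λ) :=
  LinearMap.liftBaseChange ℝ
    ((Algebra.linearMap ℤ ℝ).comp (Module.Dual.eval ℤ Λ (D.c i)))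

/-- The simple coroot `α_i^∨` as an element of the real Cartan subalgebra. -/
noncomputable def coroot (i : ι) : RealCartan Λ := (1 : ℝ) ⊗ₜ[ℤ] D.d i

theorem root_coroot (i j : ι) : D.root j (D.coroot i) = (D.A i j : ℝ) := by
  simp [root, coroot, D.pairing]

theorem root_coroot_self (i : ι) : D.root i (D.coroot i) = 2 := by
  simp [D.root_coroot, D.isGCM.diag]

open Classical in
/-- The Coxeter matrix of the Weyl group. -/
noncomputable def coxeterMatrix : CoxeterMatrix ι where
  M := fun i j => if i = j then 1 else coxeterOrder (D.A i j * D.A j i)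
  isSymm := Matrix.IsSymm.ext fun i j => by
    rw [mul_comm (D.A j i)]
    simp only [eq_comm (a := j)]
  diagonal := fun i => by simp
  off_diagonal := fun i j hij => by
    simp only [if_neg hij, coxeterOrder]
    split_ifs <;> norm_num

/-- The Weyl group, defined by its Coxeter presentation. -/
abbrev WeylGroup : Type _ := D.coxeterMatrix.Group

/-- The simple reflection `h ↦ h - ⟨α_i, h⟩ α_i^∨` of the real Cartan subalgebra. -/
noncomputable def simpleReflection (i : ι) : RealCartan Λ ≃ₗ[ℝ] RealCartan Λ :=
  Module.reflection (D.root_coroot_self i)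

theorem simpleReflection_liftable : D.coxeterMatrix.IsLiftable D.simpleReflection := by
  intro i j
  by_cases hij : i = j
  · subst hij
    rw [D.coxeterMatrix.diagonal, pow_one]
    ext z
    exact Module.involutive_reflection (D.root_coroot_self i) z
  · have hM : D.coxeterMatrix.M i j = coxeterOrder (D.A i j * D.A j i) := by
      simp [coxeterMatrix, hij]
    rw [hM]
    have key : ∀ p : ℤ, D.A i j * D.A j i = p →
        D.root i (D.coroot j) * D.root j (D.coroot i) - 2 = (p : ℝ) - 2 := by
      intro p hp
      rw [D.root_coroot, D.root_coroot, ← hp]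
      push_cast
      ring
    unfold coxeterOrder simpleReflection
    split_ifs with h0 h1 h2 h3
    · have hA : D.A i j = 0 ∧ D.A j i = 0 := by
        rcases mul_eq_zero.mp h0 with h | h
        · exact ⟨h, (D.isGCM.zero_iff i j).mp h⟩
        · exact ⟨(D.isGCM.zero_iff i j).mpr h, h⟩
      have e1 : D.root i (D.coroot j) = 0 := by simp [D.root_coroot, hA.2]
      have e2 : D.root j (D.coroot i) = 0 := by simp [D.root_coroot, hA.1]
      ext z
      rw [Module.reflection_mul_reflection_pow_apply _ _ 2 z _ (key 0 h0).symm]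
      norm_num [e1, e2]
      module
    · ext z
      rw [Module.reflection_mul_reflection_pow_apply _ _ 3 z _ (key 1 h1).symm]
      norm_num [Polynomial.Chebyshev.S_two]
    · ext z
      rw [Module.reflection_mul_reflection_pow_apply _ _ 4 z _ (key 2 h2).symm]
      norm_num [Polynomial.Chebyshev.S_two]
    · ext z
      rw [Module.reflection_mul_reflection_pow_apply _ _ 6 z _ (key 3 h3).symm]
      norm_num [Polynomial.Chebyshev.S_two]
    · exact pow_zero _

/-- The action of the Weyl group on the real Cartan subalgebra. -/
noncomputable def weylAction : D.WeylGroup →* (RealCartan Λ ≃ₗ[ℝ] RealCartan Λ) :=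
  D.coxeterMatrix.toCoxeterSystem.lift ⟨D.simpleReflection, D.simpleReflection_liftable⟩

/-- The standard subgroup `W_J` generated by the simple reflections `s_j` with `j ∈ J`. -/
noncomputable def standardSubgroup (J : Set ι) : Subgroup D.WeylGroup :=
  Subgroup.closure (D.coxeterMatrix.simple '' J)

/-- The orbit of the point `y` under the standard subgroup `W_J`. -/
def orbit (J : Set ι) (y : RealCartan Λ) : Set (RealCartan Λ) :=
  {z | ∃ w ∈ D.standardSubgroup J, z = D.weylAction w y}

/-- The open fundamental chamber of the standard subgroup `W_J`. -/
def openChamber (J : Set ι) : Set (RealCartan Λ) :=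
  {y | ∀ k ∈ J, 0 < D.root k y}

/-- The convex hull `Ξ_h` of the Weyl group orbit of `h`. -/
def orbitHull (h : RealCartan Λ) : Set (RealCartan Λ) :=
  convexHull ℝ {z | ∃ w : D.WeylGroup, z = D.weylAction w h}

/-- The affine space `E_h = h + span {α_i^∨}`. -/
def orbitSpace (h : RealCartan Λ) : Set (RealCartan Λ) :=
  {y | y - h ∈ Submodule.span ℝ (Set.range D.coroot)}

/-- The level set `{y ∈ E_h | ω y = t}` of a linear functional `ω`. -/
def levelPlane (h : RealCartan Λ) (ω : Module.Dual ℝ (RealCartan Λ)) (t : ℝ) :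
    Set (RealCartan Λ) :=
  {y | y ∈ D.orbitSpace h ∧ ω y = t}

/-- The slice of `Ξ_h` by the level set of `ω` at height `t`. -/
def slice (h : RealCartan Λ) (ω : Module.Dual ℝ (RealCartan Λ)) (t : ℝ) :
    Set (RealCartan Λ) :=
  D.orbitHull h ∩ D.levelPlane h ω t

end KacMoodyRootDatum

/-- A face of a convex set `P`: a non-empty convex subset `F` of `P` such that every segment in `P`
whose relative interior meets `F` is contained in `F`. -/
def IsFace {V : Type*} [AddCommGroup V] [Module ℝ V] (P F : Set V) : Prop :=
  F.Nonempty ∧ Convex ℝ F ∧ IsExtreme ℝ P F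

/-- The essential part of a convex set `P` with respect to the standard subgroup `W_J`: the union
of all faces of `P` that are contained in the open fundamental chamber of `W_J`. -/
def KacMoodyRootDatum.essentialPart {ι Λ : Type*} [AddCommGroup Λ] (D : KacMoodyRootDatum ι Λ)
    (J : Set ι) (P : Set (RealCartan Λ)) : Set (RealCartan Λ) :=
  {y | ∃ F : Set (RealCartan Λ), IsFace P F ∧ F ⊆ D.openChamber J ∧ y ∈ F}

/-! Let `J = {i}ᶜ`, and order points by `x ≤ y` when `y - x` is a nonnegative combination of the
coroots in `J`. Each orbit point of `h` has a `W_J`-conjugate in the open chamber of `J`. Hulls of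
dominant points add (`add_mem_orbitHull`), so every `x ∈ Ξ_h` lies in `conv (W_J p)` for some `p ∈
Ξ_h` in that chamber (`exists_openChamber_mem_orbitHull_restrict`).

Choose `y ∈ Ξ_h` maximal above `p`. Consider the face of the slice formed by the points `z` with `y
= a z + b z'`, where `a, b > 0`. Lift `z ≤ q` and `z' ≤ q'` into the chamber; then `y ≤ a q + b q'`,
maximality forces equality, and `z = q` lies in the chamber. So `y` is essential
(`mem_essentialPart_of_maximal`). Since `p ≤ y` are both strictly dominant for `J`, `p ∈ conv (W_J
y)` (`mem_orbitHull_of_sub_mem_corootCone`), hence so is `x`. The functional is constant along all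
of this because it kills the coroots in `J`. The reverse inclusion is the invariance of `Ξ_h`.

Maximal points exist because `Ξ_h` is closed (`isClosed_setOf_mem_orbitHull`), the delicate point
for infinite `W`. By Carathéodory each point of `Ξ_h` has weight at least a fixed `l > 0` on some
vertex `w h`. Near a limit point only finitely many `w` can occur, so the limit is itself a
combination with positive weight on a conjugate of a strictly dominant point. Hence its dominant
conjugate has a finite stabilizer, and averaging over that stabilizer puts it in `Ξ_h`. -/

/-! ### Positivity of roots in rank two -/

/-- The coefficients of the linear functionals obtained from one of two simple roots by applying an
alternating word of length `n` in the two simple reflections. -/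
def dihedralCoeff (a b : ℤ) : ℕ → ℤ × ℤ
  | 0 => (1, 0)
  | n + 1 =>
    if Even n then ((dihedralCoeff a b n).1, a * (dihedralCoeff a b n).1 - (dihedralCoeff a b n).2)
    else (b * (dihedralCoeff a b n).2 - (dihedralCoeff a b n).1, (dihedralCoeff a b n).2)

/-- For `a * b ≥ 4` the parity-dependent inequalities are an invariant: they say that the coordinate
about to be replaced does not decrease. -/
theorem dihedralCoeff_growth {a b : ℤ} (ha : 0 ≤ a) (hb : 0 ≤ b) (hab : 4 ≤ a * b) (n : ℕ) :
    0 ≤ (dihedralCoeff a b n).1 ∧ 0 ≤ (dihedralCoeff a b n).2 ∧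
      (Even n → 2 * (dihedralCoeff a b n).2 ≤ a * (dihedralCoeff a b n).1) ∧
      (¬ Even n → 2 * (dihedralCoeff a b n).1 ≤ b * (dihedralCoeff a b n).2) := by
  induction n with
  | zero => simpa [dihedralCoeff] using ha
  | succ n ih =>
    obtain ⟨h1, h2, h3, h4⟩ := ih
    by_cases hn : Even n
    · have := h3 hn
      simp only [dihedralCoeff, hn, if_true, Nat.even_add_one, not_true_eq_false, false_implies,
        not_false_eq_true, true_implies, true_and]
      refine ⟨h1, by linarith, ?_⟩
      nlinarith [mul_le_mul_of_nonneg_left this hb, mul_le_mul_of_nonneg_right hab h1]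
    · have := h4 hn
      simp only [dihedralCoeff, hn, if_false, Nat.even_add_one, not_true_eq_false, false_implies,
        not_false_eq_true, true_implies, and_true]
      refine ⟨by linarith, h2, ?_⟩
      nlinarith [mul_le_mul_of_nonneg_left this ha, mul_le_mul_of_nonneg_right hab h2]

/-- The finite orders leave finitely many `n` to check; order `0` encodes infinity and imposes no
bound on `n`. -/
theorem dihedralCoeff_nonneg {a b : ℤ} (ha : 0 ≤ a) (hb : 0 ≤ b) (h0 : a = 0 ↔ b = 0) (n : ℕ)
    (hn : coxeterOrder (a * b) ≠ 0 → n < coxeterOrder (a * b)) :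
    0 ≤ (dihedralCoeff a b n).1 ∧ 0 ≤ (dihedralCoeff a b n).2 := by
  have hab : 0 ≤ a * b := mul_nonneg ha hb
  unfold coxeterOrder at hn
  split_ifs at hn with c0 c1 c2 c3
  · replace hn := hn (by norm_num)
    have hb0 : a = 0 := by
      rcases mul_eq_zero.mp c0 with h | h
      · exact h
      · exact h0.mpr h
    interval_cases n <;> simp [dihedralCoeff, hb0]
  · replace hn := hn (by norm_num)
    have c1' : b * a = 1 := by rw [mul_comm]; exact c1
    interval_cases n <;> simp [dihedralCoeff, Nat.even_iff, c1', ha]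
  · replace hn := hn (by norm_num)
    have c2' : b * a = 2 := by rw [mul_comm]; exact c2
    interval_cases n <;> simp [dihedralCoeff, Nat.even_iff, c2', ha]
  · replace hn := hn (by norm_num)
    have c3' : b * a = 3 := by rw [mul_comm]; exact c3
    interval_cases n <;>
      simp [dihedralCoeff, Nat.even_iff, c3', ha, mul_sub, ← mul_assoc] <;> linarith
  · have h4 : 4 ≤ a * b := by omega
    exact ⟨(dihedralCoeff_growth ha hb h4 n).1, (dihedralCoeff_growth ha hb h4 n).2.1⟩

/-! ### The Weyl group action and positive roots -/

namespace KacMoodyRootDatum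

variable {ι Λ : Type*} [AddCommGroup Λ] (D : KacMoodyRootDatum ι Λ)

/-- The Weyl group as a Coxeter system. -/
noncomputable abbrev cox : CoxeterSystem D.coxeterMatrix D.WeylGroup :=
  D.coxeterMatrix.toCoxeterSystem

theorem weylAction_simple (k : ι) : D.weylAction (D.cox.simple k) = D.simpleReflection k :=
  D.cox.lift_apply_simple D.simpleReflection_liftable k

theorem simpleReflection_apply (k : ι) (y : RealCartan Λ) :
    D.simpleReflection k y = y - D.root k y • D.coroot k :=
  Module.reflection_apply _ _

theorem weylAction_simple_apply (k : ι) (y : RealCartan Λ) :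
    D.weylAction (D.cox.simple k) y = y - D.root k y • D.coroot k := by
  rw [weylAction_simple, simpleReflection_apply]

theorem weylAction_mul_apply (v w : D.WeylGroup) (y : RealCartan Λ) :
    D.weylAction (v * w) y = D.weylAction v (D.weylAction w y) := by
  rw [map_mul]; rfl

theorem weylAction_inv_apply_self (w : D.WeylGroup) (y : RealCartan Λ) :
    D.weylAction w⁻¹ (D.weylAction w y) = y := by
  rw [← weylAction_mul_apply, inv_mul_cancel, map_one]; rfl

theorem weylAction_apply_inv_self (w : D.WeylGroup) (y : RealCartan Λ) :
    D.weylAction w (D.weylAction w⁻¹ y) = y := by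
  rw [← weylAction_mul_apply, mul_inv_cancel, map_one]; rfl

theorem root_weylAction_alternatingWord {s t : ι} (n : ℕ) (y : RealCartan Λ) :
    D.root s (D.weylAction (D.cox.wordProd (CoxeterSystem.alternatingWord s t n))⁻¹ y) =
      ((dihedralCoeff (-D.A t s) (-D.A s t) n).1 : ℝ) * D.root s y +
        ((dihedralCoeff (-D.A t s) (-D.A s t) n).2 : ℝ) * D.root t y := by
  induction n generalizing y with
  | zero => simp [CoxeterSystem.alternatingWord, dihedralCoeff]
  | succ n ih =>
    rw [CoxeterSystem.alternatingWord_succ', CoxeterSystem.wordProd_cons, mul_inv_rev,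
      CoxeterSystem.inv_simple, weylAction_mul_apply, ih]
    by_cases hn : Even n
    · simp only [hn, if_true, weylAction_simple_apply, dihedralCoeff, map_sub, map_smul,
        root_coroot, D.isGCM.diag, smul_eq_mul]
      push_cast
      ring
    · simp only [hn, if_false, weylAction_simple_apply, dihedralCoeff, map_sub, map_smul,
        root_coroot, D.isGCM.diag, smul_eq_mul]
      push_cast
      ring

/-- The linear functionals that are combinations of simple roots with natural coefficients. -/
def rootMonoid : AddSubmonoid (Module.Dual ℝ (RealCartan Λ)) :=
  AddSubmonoid.closure (Set.range D.root)

theorem root_mem_rootMonoid (k : ι) : D.root k ∈ D.rootMonoid :=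
  AddSubmonoid.subset_closure ⟨k, rfl⟩

theorem coxeterMatrix_apply_of_ne {s t : ι} (hst : s ≠ t) :
    D.coxeterMatrix s t = coxeterOrder (D.A s t * D.A t s) := by
  simp [coxeterMatrix, hst]

/-- If `s w` is longer than `w`, then the transform of the simple root `α_s` under the inverse of
`w` is a positive root. -/
theorem root_comp_weylAction_mem (w : D.WeylGroup) (s : ι) (hs : ¬ D.cox.IsLeftDescent w s) :
    D.root s ∘ₗ (D.weylAction w : RealCartan Λ →ₗ[ℝ] RealCartan Λ) ∈ D.rootMonoid := by
  induction hl : D.cox.length w using Nat.strong_induction_on generalizing w s with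
  | _ l ih =>
  subst hl
  by_cases hw : w = 1
  · subst hw
    rw [map_one]
    exact D.root_mem_rootMonoid s
  obtain ⟨t, ht⟩ := D.cox.exists_leftDescent_of_ne_one hw
  have hst : s ≠ t := by rintro rfl; exact hs ht
  -- `Q n` says that an alternating prefix of length `n`, starting with `t`, splits off `w` with
  -- lengths adding. For the largest such `n`, the remainder `v` has neither `s` nor `t` as a left
  -- descent: one would prolong the prefix, the other would shorten `w`.
  let Q : ℕ → Prop := fun n => ∃ v,
    w = (D.cox.wordProd (CoxeterSystem.alternatingWord s t n))⁻¹ * v ∧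
      D.cox.length v + n = D.cox.length w
  classical
  have hQ1 : Q 1 := by
    refine ⟨D.cox.simple t * w, ?_, ?_⟩
    · simp [CoxeterSystem.alternatingWord]
    · exact D.cox.isLeftDescent_iff.mp ht
  have hlen : 1 ≤ D.cox.length w := by
    rcases hQ1 with ⟨v, -, h⟩; omega
  set n := Nat.findGreatest Q (D.cox.length w) with hn
  have hQn : Q n := Nat.findGreatest_spec hlen hQ1
  have h1n : 1 ≤ n := Nat.le_findGreatest hlen hQ1
  have hmax : ¬ Q (n + 1) := by
    intro h
    have : n + 1 ≤ D.cox.length w := by rcases h with ⟨v, -, h⟩; omega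
    have := Nat.le_findGreatest (P := Q) this h
    omega
  obtain ⟨v, hv, hvl⟩ := hQn
  have hlt : D.cox.length v < D.cox.length w := by omega
  have halt : ∀ p q k, D.cox.length (D.cox.wordProd (CoxeterSystem.alternatingWord p q k)) ≤ k := by
    intro p q k
    have := D.cox.length_wordProd_le (CoxeterSystem.alternatingWord p q k)
    rwa [CoxeterSystem.length_alternatingWord] at this
  have hnext : ¬ D.cox.IsLeftDescent v (if Even n then t else s) := by
    intro h
    apply hmax
    refine ⟨D.cox.simple (if Even n then t else s) * v, ?_, ?_⟩
    · rw [CoxeterSystem.alternatingWord_succ', CoxeterSystem.wordProd_cons, mul_inv_rev,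
        CoxeterSystem.inv_simple, mul_assoc, CoxeterSystem.simple_mul_simple_cancel_left]
      exact hv
    · have := D.cox.isLeftDescent_iff.mp h
      omega
  have hprev : ¬ D.cox.IsLeftDescent v (if Even n then s else t) := by
    intro h
    have h' := D.cox.isLeftDescent_iff.mp h
    obtain ⟨m, hm⟩ : ∃ m, n = m + 1 := ⟨n - 1, by omega⟩
    have hpar : (if Even n then s else t) = if Even m then t else s := by
      rw [hm]
      by_cases hE : Even m <;> simp [Nat.even_add_one, hE]
    rw [hpar] at h'
    rw [hm, CoxeterSystem.alternatingWord_succ', CoxeterSystem.wordProd_cons, mul_inv_rev,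
      CoxeterSystem.inv_simple, mul_assoc] at hv
    have h1 := D.cox.length_mul_le (D.cox.wordProd (CoxeterSystem.alternatingWord s t m))⁻¹
      (D.cox.simple (if Even m then t else s) * v)
    rw [← hv, D.cox.length_inv] at h1
    have := halt s t m
    omega
  have hs' : ¬ D.cox.IsLeftDescent v s := by
    by_cases h : Even n
    · simpa [h] using hprev
    · simpa [h] using hnext
  have ht' : ¬ D.cox.IsLeftDescent v t := by
    by_cases h : Even n
    · simpa [h] using hnext
    · simpa [h] using hprev
  -- If the prefix were as long as the braid relation, that relation would rewrite it to start with
  -- `s`, making `s` a left descent of `w`.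
  have hbound : D.coxeterMatrix s t ≠ 0 → n < D.coxeterMatrix s t := by
    intro h0
    by_contra hge
    push Not at hge
    apply hs
    rw [D.cox.isLeftDescent_iff]
    have hsplit : ∀ k, ∃ u, D.cox.length u ≤ k ∧ D.cox.wordProd
        (CoxeterSystem.alternatingWord s t (D.coxeterMatrix s t + k)) =
          u * D.cox.wordProd (CoxeterSystem.alternatingWord s t (D.coxeterMatrix s t)) := by
      intro k
      induction k with
      | zero => exact ⟨1, by simp, by simp⟩
      | succ k ihk =>
        obtain ⟨u, hu, hu'⟩ := ihk
        refine ⟨D.cox.simple (if Even (D.coxeterMatrix s t + k) then t else s) * u, ?_, ?_⟩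
        · have := D.cox.length_mul_le
            (D.cox.simple (if Even (D.coxeterMatrix s t + k) then t else s)) u
          rw [D.cox.length_simple] at this
          omega
        · rw [← add_assoc, CoxeterSystem.alternatingWord_succ', CoxeterSystem.wordProd_cons, hu',
            mul_assoc]
    obtain ⟨u, hu, hu'⟩ := hsplit (n - D.coxeterMatrix s t)
    rw [Nat.add_sub_cancel' hge] at hu'
    have hbraid := D.cox.wordProd_braidWord_eq s t
    unfold CoxeterSystem.braidWord at hbraid
    rw [← D.coxeterMatrix.symmetric s t] at hbraid
    obtain ⟨m, hm⟩ : ∃ m, D.coxeterMatrix s t = m + 1 := ⟨D.coxeterMatrix s t - 1, by omega⟩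
    rw [hbraid, hm, CoxeterSystem.alternatingWord_succ, CoxeterSystem.wordProd_concat] at hu'
    rw [hu', mul_inv_rev, mul_inv_rev, CoxeterSystem.inv_simple, mul_assoc, mul_assoc] at hv
    rw [hm] at hu hge
    have h1 := D.cox.length_mul_le (D.cox.wordProd (CoxeterSystem.alternatingWord s t m))⁻¹
      (u⁻¹ * v)
    have h2 := D.cox.length_mul_le u⁻¹ v
    rw [D.cox.length_inv] at h1 h2
    have h3 := halt s t m
    have h4 : D.cox.simple s * w =
        (D.cox.wordProd (CoxeterSystem.alternatingWord s t m))⁻¹ * (u⁻¹ * v) := by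
      rw [hv, CoxeterSystem.simple_mul_simple_cancel_left]
    rw [← h4] at h1
    rcases D.cox.length_simple_mul w s with h | h
    · omega
    · exact h
  have hneg : ∀ i j, i ≠ j → 0 ≤ -D.A i j := fun i j hij => by
    have := D.isGCM.off_diag i j hij; omega
  obtain ⟨hx, hy⟩ := dihedralCoeff_nonneg (hneg t s hst.symm) (hneg s t hst)
    (by rw [neg_eq_zero, neg_eq_zero]; exact D.isGCM.zero_iff t s) n
    (by rw [D.coxeterMatrix_apply_of_ne hst] at hbound
        rwa [neg_mul_neg, mul_comm])
  have hmain := D.root_weylAction_alternatingWord (s := s) (t := t) n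
  obtain ⟨x, hx⟩ := Int.eq_ofNat_of_zero_le hx
  obtain ⟨z, hz⟩ := Int.eq_ofNat_of_zero_le hy
  rw [hx, hz] at hmain
  have heq : D.root s ∘ₗ (D.weylAction w : RealCartan Λ →ₗ[ℝ] RealCartan Λ) =
      x • (D.root s ∘ₗ (D.weylAction v : RealCartan Λ →ₗ[ℝ] RealCartan Λ)) +
        z • (D.root t ∘ₗ (D.weylAction v : RealCartan Λ →ₗ[ℝ] RealCartan Λ)) := by
    apply LinearMap.ext
    intro y
    conv_lhs => rw [hv]
    simp only [LinearMap.comp_apply, LinearEquiv.coe_coe, weylAction_mul_apply, hmain,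
      LinearMap.add_apply, LinearMap.smul_apply]
    simp
  rw [heq]
  exact add_mem (nsmul_mem (ih _ hlt v s hs' rfl) x) (nsmul_mem (ih _ hlt v t ht' rfl) z)

theorem nonneg_of_mem_rootMonoid {φ : Module.Dual ℝ (RealCartan Λ)} (hφ : φ ∈ D.rootMonoid)
    {y : RealCartan Λ} (hy : ∀ k, 0 ≤ D.root k y) : 0 ≤ φ y := by
  induction hφ using AddSubmonoid.closure_induction with
  | mem φ h => obtain ⟨k, rfl⟩ := h; exact hy k
  | zero => simp
  | add φ ψ _ _ h1 h2 => simpa using add_nonneg h1 h2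

/-- Integrality matters here: a nonzero element involves some simple root with coefficient at least
`1`. -/
theorem le_of_mem_rootMonoid {φ : Module.Dual ℝ (RealCartan Λ)} (hφ : φ ∈ D.rootMonoid)
    {y : RealCartan Λ} {ε : ℝ} (hε : 0 ≤ ε) (hy : ∀ k, ε ≤ D.root k y) (h0 : φ ≠ 0) :
    ε ≤ φ y := by
  have : φ = 0 ∨ ε ≤ φ y := by
    clear h0
    induction hφ using AddSubmonoid.closure_induction with
    | mem φ h => obtain ⟨k, rfl⟩ := h; exact Or.inr (hy k)
    | zero => simp
    | add φ ψ _ _ h1 h2 =>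
      rcases h1 with rfl | h1
      · simpa using h2
      · rcases h2 with rfl | h2
        · simpa using Or.inr h1
        · right
          simp only [LinearMap.add_apply]
          linarith
  exact this.resolve_left h0

/-- The closed fundamental chamber is sent to the nonnegative side of the wall of `s` by an element
without left descent `s`. -/
theorem root_weylAction_nonneg {w : D.WeylGroup} {s : ι} (hs : ¬ D.cox.IsLeftDescent w s)
    {y : RealCartan Λ} (hy : ∀ k, 0 ≤ D.root k y) : 0 ≤ D.root s (D.weylAction w y) :=
  D.nonneg_of_mem_rootMonoid (D.root_comp_weylAction_mem w s hs) hy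

theorem le_root_weylAction {w : D.WeylGroup} {s : ι} (hs : ¬ D.cox.IsLeftDescent w s)
    {y : RealCartan Λ} {ε : ℝ} (hε : 0 ≤ ε) (hy : ∀ k, ε ≤ D.root k y) :
    ε ≤ D.root s (D.weylAction w y) := by
  refine D.le_of_mem_rootMonoid (D.root_comp_weylAction_mem w s hs) hε hy ?_
  intro h
  have h1 := LinearMap.congr_fun h (D.weylAction w⁻¹ (D.coroot s))
  simp [root_coroot_self] at h1

/-- Induction along reduced words from the left. -/
theorem weylGroup_induction {p : D.WeylGroup → Prop} (one : p 1)
    (step : ∀ (k : ι) (w : D.WeylGroup), ¬ D.cox.IsLeftDescent w k → p w →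
      p (D.cox.simple k * w)) (w : D.WeylGroup) : p w := by
  induction hl : D.cox.length w using Nat.strong_induction_on generalizing w with
  | _ l ih =>
  subst hl
  by_cases hw : w = 1
  · exact hw ▸ one
  obtain ⟨k, hk⟩ := D.cox.exists_leftDescent_of_ne_one hw
  have h := step k (D.cox.simple k * w) (D.cox.isLeftDescent_iff_not_isLeftDescent_mul.mp hk)
    (ih _ hk _ rfl)
  rwa [CoxeterSystem.simple_mul_simple_cancel_left] at h

/-! ### The coroot cone and orbit hulls -/

/-- The convex cone generated by the simple coroots. -/
noncomputable def corootCone : PointedCone ℝ (RealCartan Λ) :=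
  PointedCone.hull ℝ (Set.range D.coroot)

theorem coroot_mem_corootCone (k : ι) : D.coroot k ∈ D.corootCone :=
  Submodule.subset_span ⟨k, rfl⟩

theorem smul_mem_corootCone {c : ℝ} (hc : 0 ≤ c) {x : RealCartan Λ} (hx : x ∈ D.corootCone) :
    c • x ∈ D.corootCone :=
  D.corootCone.smul_mem hc hx

theorem mem_corootCone_iff [Fintype ι] {x : RealCartan Λ} :
    x ∈ D.corootCone ↔ ∃ c : ι → ℝ, (∀ k, 0 ≤ c k) ∧ x = ∑ k, c k • D.coroot k := by
  constructor
  · intro hx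
    obtain ⟨c, hc⟩ := (Submodule.mem_span_range_iff_exists_fun _).mp hx
    exact ⟨fun k => (c k : ℝ), fun k => (c k).2, hc.symm⟩
  · rintro ⟨c, hc, rfl⟩
    exact sum_mem fun k _ => D.smul_mem_corootCone (hc k) (D.coroot_mem_corootCone k)

theorem convex_setOf_sub_mem_corootCone (h : RealCartan Λ) :
    Convex ℝ {z | h - z ∈ D.corootCone} := by
  intro x hx y hy a b ha hb hab
  have : h - (a • x + b • y) = a • (h - x) + b • (h - y) := by
    rw [smul_sub, smul_sub, sub_add_sub_comm, ← add_smul, hab, one_smul]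
  simp only [Set.mem_ofPred_eq] at hx hy ⊢
  rw [this]
  exact add_mem (D.smul_mem_corootCone ha hx) (D.smul_mem_corootCone hb hy)

/-- Along a reduced word built from the left, each reflection subtracts a nonnegative multiple of a
simple coroot. -/
theorem sub_weylAction_mem_corootCone {y : RealCartan Λ} (hy : ∀ k, 0 ≤ D.root k y)
    (w : D.WeylGroup) : y - D.weylAction w y ∈ D.corootCone := by
  induction w using D.weylGroup_induction with
  | one => simp
  | step k w hk ih =>
    rw [weylAction_mul_apply, weylAction_simple_apply, sub_sub_eq_add_sub, add_sub_right_comm]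
    exact add_mem ih
      (D.smul_mem_corootCone (D.root_weylAction_nonneg hk hy) (D.coroot_mem_corootCone k))

theorem weylAction_mem_orbitHull (h : RealCartan Λ) (w : D.WeylGroup) :
    D.weylAction w h ∈ D.orbitHull h :=
  subset_convexHull ℝ _ ⟨w, rfl⟩

theorem self_mem_orbitHull (h : RealCartan Λ) : h ∈ D.orbitHull h := by
  simpa using D.weylAction_mem_orbitHull h 1

theorem convex_orbitHull (h : RealCartan Λ) : Convex ℝ (D.orbitHull h) := convex_convexHull _ _

theorem image_orbitHull (h : RealCartan Λ) (w : D.WeylGroup) :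
    D.weylAction w '' D.orbitHull h = D.orbitHull h := by
  have : ∀ w, D.weylAction w '' D.orbitHull h ⊆ D.orbitHull h := by
    intro w
    unfold orbitHull
    have := (D.weylAction w : RealCartan Λ →ₗ[ℝ] RealCartan Λ).image_convexHull
      {z | ∃ w : D.WeylGroup, z = D.weylAction w h}
    rw [LinearEquiv.coe_coe] at this
    rw [this]
    apply convexHull_mono
    rintro _ ⟨_, ⟨v, rfl⟩, rfl⟩
    exact ⟨w * v, (D.weylAction_mul_apply w v h).symm⟩
  apply (this w).antisymm
  intro z hz
  exact ⟨D.weylAction w⁻¹ z, this w⁻¹ ⟨z, hz, rfl⟩, D.weylAction_apply_inv_self w z⟩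

theorem weylAction_mem_orbitHull_of_mem {h z : RealCartan Λ} (hz : z ∈ D.orbitHull h)
    (w : D.WeylGroup) : D.weylAction w z ∈ D.orbitHull h := by
  rw [← D.image_orbitHull h w]
  exact ⟨z, hz, rfl⟩

theorem mem_orbitHull_of_weylAction_mem {h z : RealCartan Λ} {w : D.WeylGroup}
    (hz : D.weylAction w z ∈ D.orbitHull h) : z ∈ D.orbitHull h := by
  simpa [weylAction_inv_apply_self] using D.weylAction_mem_orbitHull_of_mem hz w⁻¹

theorem orbitHull_subset {h z : RealCartan Λ} (hz : z ∈ D.orbitHull h) :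
    D.orbitHull z ⊆ D.orbitHull h := by
  refine convexHull_min ?_ (D.convex_orbitHull h)
  rintro _ ⟨w, rfl⟩
  exact D.weylAction_mem_orbitHull_of_mem hz w

theorem sub_mem_corootCone_of_mem_orbitHull {h z : RealCartan Λ} (hh : ∀ k, 0 ≤ D.root k h)
    (hz : z ∈ D.orbitHull h) : h - z ∈ D.corootCone := by
  have : D.orbitHull h ⊆ {z | h - z ∈ D.corootCone} := by
    refine convexHull_min ?_ (D.convex_setOf_sub_mem_corootCone h)
    rintro _ ⟨w, rfl⟩
    exact D.sub_weylAction_mem_corootCone hh w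
  exact this hz

/-- A point moved in direction of a negative coroot stays in the orbit hull as long as it does not
pass the reflected point. -/
theorem sub_smul_coroot_mem_orbitHull (p : RealCartan Λ) (k : ι) {c : ℝ} (hc : 0 ≤ c)
    (hcp : c ≤ D.root k p) : p - c • D.coroot k ∈ D.orbitHull p := by
  rcases hc.eq_or_lt with rfl | hc'
  · simpa using D.self_mem_orbitHull p
  have hp : 0 < D.root k p := hc'.trans_le hcp
  have h2 := D.weylAction_mem_orbitHull p (D.cox.simple k)
  rw [weylAction_simple_apply] at h2
  have := D.convex_orbitHull p (D.self_mem_orbitHull p) h2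
    (a := 1 - c / D.root k p) (b := c / D.root k p)
    (by rw [sub_nonneg, div_le_one hp]; exact hcp) (by positivity) (by ring)
  convert this using 1
  rw [smul_sub, smul_smul, div_mul_cancel₀ _ hp.ne']
  module

/-- The sum of a dominant point and a point in the orbit of a dominant point lies in the orbit hull
of the sum. -/
theorem add_weylAction_mem_orbitHull {a b : RealCartan Λ} (ha : ∀ k, 0 ≤ D.root k a)
    (hb : ∀ k, 0 ≤ D.root k b) (w : D.WeylGroup) :
    a + D.weylAction w b ∈ D.orbitHull (a + b) := by
  induction w using D.weylGroup_induction with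
  | one => simpa using D.self_mem_orbitHull (a + b)
  | step k w hk ih =>
    have h0 := D.root_weylAction_nonneg hk hb
    refine D.orbitHull_subset ih ?_
    rw [weylAction_mul_apply, weylAction_simple_apply, ← add_sub_assoc]
    -- The move stops before the reflected point, since dominance of `a` only increases the value of
    -- `α_k`.
    refine D.sub_smul_coroot_mem_orbitHull _ k h0 ?_
    rw [map_add]
    linarith [ha k]

-- A Minkowski sum of hulls is the hull of the sums `u a + v b = u (a + u⁻¹ v b)`, which reduces to
-- the case of one group element.
open scoped Pointwise in
theorem add_mem_orbitHull {a b x y : RealCartan Λ} (ha : ∀ k, 0 ≤ D.root k a)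
    (hb : ∀ k, 0 ≤ D.root k b) (hx : x ∈ D.orbitHull a) (hy : y ∈ D.orbitHull b) :
    x + y ∈ D.orbitHull (a + b) := by
  have : x + y ∈ D.orbitHull a + D.orbitHull b := Set.add_mem_add hx hy
  unfold orbitHull at this
  rw [← convexHull_add] at this
  refine convexHull_min ?_ (D.convex_orbitHull (a + b)) this
  rintro _ ⟨_, ⟨u, rfl⟩, _, ⟨v, rfl⟩, rfl⟩
  have h1 := D.weylAction_mem_orbitHull_of_mem (D.add_weylAction_mem_orbitHull ha hb (u⁻¹ * v)) u
  rwa [map_add, ← weylAction_mul_apply, mul_inv_cancel_left] at h1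

open scoped Pointwise in
theorem smul_mem_orbitHull {a x : RealCartan Λ} (c : ℝ) (hx : x ∈ D.orbitHull a) :
    c • x ∈ D.orbitHull (c • a) := by
  have : D.orbitHull (c • a) = c • D.orbitHull a := by
    unfold orbitHull
    rw [← convexHull_smul]
    congr 1
    ext z
    constructor
    · rintro ⟨w, rfl⟩
      exact ⟨_, ⟨w, rfl⟩, by simp⟩
    · rintro ⟨_, ⟨w, rfl⟩, rfl⟩
      exact ⟨w, by simp⟩
  rw [this]
  exact Set.smul_mem_smul_set hx

/-- A strictly dominant point below a strictly dominant point lies in the hull of its orbit. -/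
theorem mem_orbitHull_of_sub_mem_corootCone [Fintype ι] {z h : RealCartan Λ}
    (hz : ∀ k, 0 < D.root k z) (hh : ∀ k, 0 < D.root k h) (hzh : h - z ∈ D.corootCone) :
    z ∈ D.orbitHull h := by
  rcases isEmpty_or_nonempty ι with hι | hι
  · obtain ⟨c, -, hc⟩ := D.mem_corootCone_iff.mp hzh
    simp only [Finset.univ_eq_empty, Finset.sum_empty, sub_eq_zero] at hc
    exact hc ▸ D.self_mem_orbitHull h
  obtain ⟨c, hc, hsum⟩ := D.mem_corootCone_iff.mp hzh
  obtain ⟨δ, hδ, hδh⟩ : ∃ δ > 0, ∀ k, δ ≤ D.root k h ∧ δ ≤ D.root k z := by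
    obtain ⟨k₀, -, hk₀⟩ := Finset.exists_min_image Finset.univ
      (fun k => min (D.root k h) (D.root k z)) Finset.univ_nonempty
    exact ⟨_, lt_min (hh k₀) (hz k₀), fun k => le_min_iff.mp (hk₀ k (Finset.mem_univ k))⟩
  -- The segment from `h` to `z` is walked in `N` equal steps. All simple roots are at least `δ`
  -- along it, and `N` makes each single-coroot move `n * c k / N` at most `δ`.
  let n : ℝ := Fintype.card ι
  have hn : 0 < n := by simpa [n] using Fintype.card_pos
  obtain ⟨N, hN, hNc⟩ : ∃ N : ℕ, 0 < N ∧ ∀ k, n * c k / N ≤ δ := by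
    obtain ⟨N, hN⟩ := exists_nat_gt (∑ k, n * c k / δ)
    have h0 : 0 ≤ ∑ k, n * c k / δ :=
      Finset.sum_nonneg fun k _ => div_nonneg (mul_nonneg hn.le (hc k)) hδ.le
    have hN0 : (0 : ℝ) < N := h0.trans_lt hN
    refine ⟨N, by exact_mod_cast hN0, fun k => ?_⟩
    have h1 : n * c k / δ ≤ ∑ k, n * c k / δ :=
      Finset.single_le_sum (fun k _ => div_nonneg (mul_nonneg hn.le (hc k)) hδ.le)
        (Finset.mem_univ k)
    rw [div_le_iff₀ hN0, mul_comm δ, ← div_le_iff₀ hδ]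
    linarith
  have hN' : (0 : ℝ) < N := by exact_mod_cast hN
  have hstep : ∀ m : ℕ, m ≤ N → h - ((m : ℝ) / N) • (h - z) ∈ D.orbitHull h := by
    intro m
    induction m with
    | zero => intro _; simpa using D.self_mem_orbitHull h
    | succ m ih =>
      intro hm
      refine D.orbitHull_subset (ih (by omega)) ?_
      set p := h - ((m : ℝ) / N) • (h - z) with hp
      have hle : (m : ℝ) / N ≤ 1 := by
        rw [div_le_one hN']; exact_mod_cast (by omega : m ≤ N)
      have hpos : 0 ≤ (m : ℝ) / N := by positivity
      have hpδ : ∀ k, δ ≤ D.root k p := by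
        intro k
        rw [hp, map_sub, map_smul, map_sub, smul_eq_mul]
        nlinarith [(hδh k).1, (hδh k).2]
      -- One step is the average of `n` moves, each along one coroot and `n` times too long; each
      -- stays between `p` and its reflection.
      have heq : h - (((m + 1 : ℕ) : ℝ) / N) • (h - z) =
          ∑ k, (1 / n) • (p - (n * c k / N) • D.coroot k) := by
        rw [← Finset.smul_sum, Finset.sum_sub_distrib, Finset.sum_const, Finset.card_univ,
          ← Nat.cast_smul_eq_nsmul ℝ, smul_sub (1 / n), smul_smul]
        change _ = (1 / n * n) • p - _
        rw [one_div_mul_cancel hn.ne', one_smul]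
        have : (1 / n) • ∑ k, (n * c k / N) • D.coroot k = ((1 : ℝ) / N) • (h - z) := by
          rw [hsum, Finset.smul_sum, Finset.smul_sum]
          refine Finset.sum_congr rfl fun k _ => ?_
          rw [smul_smul, smul_smul]
          congr 1
          field_simp
        rw [this, hp, sub_sub, ← add_smul]
        congr 2
        push_cast
        ring
      rw [heq]
      refine (D.convex_orbitHull p).sum_mem (fun _ _ => by positivity) ?_ fun k _ =>
        D.sub_smul_coroot_mem_orbitHull p k
          (div_nonneg (mul_nonneg hn.le (hc k)) hN'.le) ((hNc k).trans (hpδ k))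
      simp [n]
  have := hstep N le_rfl
  rwa [div_self hN'.ne', one_smul, sub_sub_cancel] at this

/-! ### Finiteness of the high part of an orbit -/

theorem finite_setOf_length_le [Finite ι] (n : ℕ) : {w | D.cox.length w ≤ n}.Finite := by
  refine ((List.finite_length_le ι n).image D.cox.wordProd).subset ?_
  intro w hw
  obtain ⟨l, hl, rfl⟩ := D.cox.exists_isReduced w
  exact ⟨l, by rw [Set.mem_ofPred_eq, ← hl.eq]; exact hw, rfl⟩

/-- Every letter of a reduced word lowers `ρ` by at least `ε`, so high orbit points come from short
words. -/
theorem functional_weylAction_le {h : RealCartan Λ} {ε : ℝ} (hε : 0 ≤ ε)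
    (hh : ∀ k, ε ≤ D.root k h) {ρ : Module.Dual ℝ (RealCartan Λ)} (hρ : ∀ k, ρ (D.coroot k) = 1)
    (w : D.WeylGroup) : ρ (D.weylAction w h) ≤ ρ h - ε * D.cox.length w := by
  induction w using D.weylGroup_induction with
  | one => simp
  | step k w hk ih =>
    rw [D.cox.not_isLeftDescent_iff.mp hk, weylAction_mul_apply, weylAction_simple_apply, map_sub,
      map_smul, hρ, smul_eq_mul, mul_one]
    have := D.le_root_weylAction hk hε hh
    push_cast
    linarith

theorem exists_pos_forall_le_root [Finite ι] {h : RealCartan Λ} (hh : ∀ k, 0 < D.root k h) :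
    ∃ ε > 0, ∀ k, ε ≤ D.root k h := by
  rcases isEmpty_or_nonempty ι with hι | hι
  · exact ⟨1, one_pos, fun k => isEmptyElim k⟩
  · obtain ⟨k₀, hk₀⟩ := Finite.exists_min fun k => D.root k h
    exact ⟨_, hh k₀, hk₀⟩

/-- Only finitely many points of the orbit of a strictly dominant point are not low. -/
theorem finite_setOf_le_functional [Finite ι] {h : RealCartan Λ} (hh : ∀ k, 0 < D.root k h)
    {ρ : Module.Dual ℝ (RealCartan Λ)} (hρ : ∀ k, ρ (D.coroot k) = 1) (M : ℝ) :
    {w | M ≤ ρ (D.weylAction w h)}.Finite := by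
  obtain ⟨ε, hε, hεh⟩ := D.exists_pos_forall_le_root hh
  obtain ⟨n, hn⟩ := exists_nat_gt ((ρ h - M) / ε)
  refine (D.finite_setOf_length_le n).subset fun w hw => ?_
  have h1 := D.functional_weylAction_le hε.le hεh hρ w
  rw [div_lt_iff₀ hε] at hn
  simp only [Set.mem_ofPred_eq] at hw ⊢
  have h2 : ε * (D.cox.length w : ℝ) < ε * n := by linarith
  exact_mod_cast (lt_of_mul_lt_mul_left h2 hε.le).le

end KacMoodyRootDatum

/-- In finite dimension, every point of a convex hull is a convex combination, with a uniform
positive weight on the first point, of a point of the set and a point of the convex hull. -/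
theorem exists_combo_of_mem_convexHull {V : Type*} [AddCommGroup V] [Module ℝ V]
    [FiniteDimensional ℝ V] {s : Set V} {x : V} (hx : x ∈ convexHull ℝ s) :
    ∃ p ∈ s, ∃ q ∈ convexHull ℝ s,
      x = (1 / (Module.finrank ℝ V + 2) : ℝ) • p + (1 - 1 / (Module.finrank ℝ V + 2) : ℝ) • q := by
  obtain ⟨J, _, z, w, hz, hind, hw, hw1, rfl⟩ := eq_pos_convex_span_of_mem_convexHull hx
  classical
  set d := Module.finrank ℝ V
  have hcard : (Fintype.card J : ℝ) ≤ d + 1 := by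
    have h1 := hind.card_le_finrank_succ
    have h2 := Submodule.finrank_le (vectorSpan ℝ (Set.range z))
    exact_mod_cast (by omega : Fintype.card J ≤ d + 1)
  -- Carathéodory gives at most `d + 1` weights, so one is at least `1 / (d + 1)`. The denominator
  -- `d + 2` keeps `l < 1` even for `d = 0`, as dividing by `1 - l` requires.
  set l : ℝ := 1 / (d + 2) with hl
  have hd : (0 : ℝ) ≤ d := Nat.cast_nonneg d
  have hl0 : 0 < l := by positivity
  have hl1 : l < 1 := by rw [hl, div_lt_one (by positivity)]; linarith
  obtain ⟨i, hi⟩ : ∃ i, l ≤ w i := by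
    by_contra! hcon
    have hle : ∑ i, w i ≤ ∑ _i : J, l := Finset.sum_le_sum fun i _ => (hcon i).le
    rw [hw1, Finset.sum_const, Finset.card_univ, nsmul_eq_mul, hl] at hle
    have : (Fintype.card J : ℝ) * (1 / (d + 2)) ≤ (d + 1) * (1 / (d + 2)) :=
      mul_le_mul_of_nonneg_right hcard hl0.le
    have h3 : ((d : ℝ) + 1) * (1 / (d + 2)) < 1 := by
      rw [mul_one_div, div_lt_one (by positivity)]; linarith
    linarith
  have h1l : 0 < 1 - l := by linarith
  refine ⟨z i, hz ⟨i, rfl⟩, ∑ j, ((w j - if j = i then l else 0) / (1 - l)) • z j, ?_, ?_⟩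
  · refine (convex_convexHull ℝ s).sum_mem (fun j _ => div_nonneg ?_ h1l.le) ?_ fun j _ =>
      subset_convexHull ℝ s (hz ⟨j, rfl⟩)
    · split_ifs with h
      · rw [h]; linarith
      · linarith [hw j]
    · rw [← Finset.sum_div, Finset.sum_sub_distrib, hw1]
      simp [h1l.ne']
  · rw [Finset.smul_sum]
    simp_rw [smul_smul, mul_div_cancel₀ _ h1l.ne', sub_smul, Finset.sum_sub_distrib]
    simp [ite_smul]

/-! ### Standard subgroups and dominant points with finite stabilizer -/

namespace KacMoodyRootDatum

variable {ι Λ : Type*} [AddCommGroup Λ] (D : KacMoodyRootDatum ι Λ)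

/-- The root datum with the same lattice and the simple roots and coroots indexed by `J`. -/
def restrict (J : Set ι) : KacMoodyRootDatum J Λ where
  A := fun i j => D.A i j
  isGCM :=
    { diag := fun i => D.isGCM.diag i
      off_diag := fun i j hij => D.isGCM.off_diag i j fun h => hij (Subtype.ext h)
      zero_iff := fun i j => D.isGCM.zero_iff i j }
  c := fun j => D.c j
  d := fun j => D.d j
  pairing := fun i j => D.pairing i j

@[simp] theorem restrict_root (J : Set ι) (k : J) : (D.restrict J).root k = D.root k := rfl

@[simp] theorem restrict_coroot (J : Set ι) (k : J) : (D.restrict J).coroot k = D.coroot k := rfl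

theorem mem_restrict_corootCone_iff [Fintype ι] {J : Set ι} {x : RealCartan Λ} :
    x ∈ (D.restrict J).corootCone ↔
      ∃ c : ι → ℝ, (∀ k, 0 ≤ c k) ∧ (∀ k ∉ J, c k = 0) ∧ x = ∑ k, c k • D.coroot k := by
  classical
  constructor
  · intro hx
    obtain ⟨c, hc, rfl⟩ := (D.restrict J).mem_corootCone_iff.mp hx
    refine ⟨fun k => if hk : k ∈ J then c ⟨k, hk⟩ else 0, fun k => ?_, fun k hk => by simp [hk], ?_⟩
    · by_cases hk : k ∈ J
      · simpa [hk] using hc ⟨k, hk⟩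
      · simp [hk]
    · rw [← Fintype.sum_subtype_add_sum_subtype (· ∈ J),
        Finset.sum_eq_zero (s := (Finset.univ : Finset {k // k ∉ J})) fun k _ => by simp [k.2],
        add_zero]
      refine Finset.sum_congr rfl fun k _ => ?_
      simp
  · rintro ⟨c, hc, hJ, rfl⟩
    refine sum_mem fun k _ => ?_
    by_cases hk : k ∈ J
    · exact (D.restrict J).smul_mem_corootCone (hc k)
        ((D.restrict J).coroot_mem_corootCone ⟨k, hk⟩)
    · rw [hJ k hk, zero_smul]
      exact zero_mem _

theorem range_weylAction : D.weylAction.range = Subgroup.closure (Set.range D.simpleReflection) := by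
  rw [MonoidHom.range_eq_map, ← D.cox.subgroup_closure_range_simple, MonoidHom.map_closure,
    ← Set.range_comp]
  congr 2

/-- The Coxeter group of the restricted datum and the standard subgroup are compared only through
their images in the linear group, which is enough for orbits. -/
theorem map_standardSubgroup (J : Set ι) :
    (D.standardSubgroup J).map D.weylAction = (D.restrict J).weylAction.range := by
  rw [range_weylAction, standardSubgroup, MonoidHom.map_closure, ← Set.image_comp]
  congr 1
  ext g
  constructor
  · rintro ⟨k, hk, rfl⟩
    exact ⟨⟨k, hk⟩, (D.weylAction_simple k).symm⟩
  · rintro ⟨k, rfl⟩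
    exact ⟨k, k.2, D.weylAction_simple k⟩

theorem orbit_eq_restrict (J : Set ι) (y : RealCartan Λ) :
    D.orbit J y = {z | ∃ w, z = (D.restrict J).weylAction w y} := by
  ext z
  constructor
  · rintro ⟨w, hw, rfl⟩
    have : D.weylAction w ∈ (D.restrict J).weylAction.range := by
      rw [← map_standardSubgroup]
      exact ⟨w, hw, rfl⟩
    obtain ⟨v, hv⟩ := this
    exact ⟨v, by rw [hv]⟩
  · rintro ⟨v, rfl⟩
    have : (D.restrict J).weylAction v ∈ (D.standardSubgroup J).map D.weylAction := by
      rw [map_standardSubgroup]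
      exact ⟨v, rfl⟩
    obtain ⟨w, hw, hwv⟩ := this
    exact ⟨w, hw, by rw [← hwv]⟩

theorem convexHull_orbit (J : Set ι) (y : RealCartan Λ) :
    convexHull ℝ (D.orbit J y) = (D.restrict J).orbitHull y := by
  rw [orbit_eq_restrict]
  rfl

theorem weylAction_eq_self_of_mem_standardSubgroup {J : Set ι} {z : RealCartan Λ}
    (hz : ∀ k ∈ J, D.root k z = 0) {w : D.WeylGroup} (hw : w ∈ D.standardSubgroup J) :
    D.weylAction w z = z := by
  induction hw using Subgroup.closure_induction with
  | mem g hg =>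
    obtain ⟨k, hk, rfl⟩ := hg
    have := D.weylAction_simple_apply k z
    rw [hz k hk, zero_smul, sub_zero] at this
    exact this
  | one => simp
  | mul u v _ _ hu hv => rw [weylAction_mul_apply, hv, hu]
  | inv u _ hu =>
    conv_lhs => rw [← hu]
    exact D.weylAction_inv_apply_self u z

/-- A dominant point below a strictly dominant point `h` lies in the hull of the orbit of `h` if
the orbit of `h` under the standard subgroup fixing it is finite. -/
theorem mem_orbitHull_of_finite_orbit [Fintype ι] {z h : RealCartan Λ}
    (hz : ∀ k, 0 ≤ D.root k z) (hh : ∀ k, 0 < D.root k h) (hzh : h - z ∈ D.corootCone)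
    (hfin : (D.orbit {k | D.root k z = 0} h).Finite) : z ∈ D.orbitHull h := by
  classical
  set K := {k | D.root k z = 0}
  set O := hfin.toFinset with hO
  have hmemO : ∀ p, p ∈ O ↔ p ∈ D.orbit K h := fun p => hfin.mem_toFinset
  have hhO : h ∈ O := (hmemO h).mpr ⟨1, one_mem _, by simp⟩
  have hn : (0 : ℝ) < O.card := by exact_mod_cast Finset.card_pos.mpr ⟨h, hhO⟩
  set n : ℝ := (O.card : ℝ) with hndef
  -- The barycenter of the `W_K`-orbit of `h` is fixed by `W_K`, so the roots in `K` vanish on it.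
  set a : RealCartan Λ := (1 / n) • ∑ p ∈ O, p with ha
  have hsO : ∀ k ∈ K, ∀ p ∈ O, D.weylAction (D.cox.simple k) p ∈ O := by
    intro k hk p hp
    rw [hmemO] at hp ⊢
    obtain ⟨w, hw, rfl⟩ := hp
    exact ⟨D.cox.simple k * w, mul_mem (Subgroup.subset_closure ⟨k, hk, rfl⟩) hw,
      (D.weylAction_mul_apply _ _ _).symm⟩
  have hss : ∀ k (p : RealCartan Λ),
      D.weylAction (D.cox.simple k) (D.weylAction (D.cox.simple k) p) = p := by
    intro k p
    rw [← weylAction_mul_apply, CoxeterSystem.simple_mul_simple_self, map_one]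
    rfl
  have hroota : ∀ k ∈ K, D.root k a = 0 := by
    intro k hk
    have h1 : D.weylAction (D.cox.simple k) a = a := by
      rw [ha, map_smul, map_sum]
      congr 1
      exact Finset.sum_nbij' (D.weylAction (D.cox.simple k)) (D.weylAction (D.cox.simple k))
        (hsO k hk) (hsO k hk) (fun p _ => hss k p) (fun p _ => hss k p) fun _ _ => rfl
    rw [weylAction_simple_apply, sub_eq_self] at h1
    have h2 := congrArg (D.root k) h1
    rw [map_smul, root_coroot_self, map_zero, smul_eq_mul] at h2
    linarith
  have hea : h - a = (1 / n) • ∑ p ∈ O, (h - p) := by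
    rw [Finset.sum_sub_distrib, Finset.sum_const, ← Nat.cast_smul_eq_nsmul ℝ, smul_sub (1 / n),
      smul_smul, one_div_mul_cancel hn.ne', one_smul]
  have he : h - a ∈ (D.restrict K).corootCone := by
    rw [hea]
    refine (D.restrict K).smul_mem_corootCone (by positivity) (sum_mem fun p hp => ?_)
    rw [hmemO, orbit_eq_restrict] at hp
    obtain ⟨w, rfl⟩ := hp
    exact (D.restrict K).sub_weylAction_mem_corootCone (fun k => (hh k).le) w
  obtain ⟨e, -, heK, hsume⟩ := D.mem_restrict_corootCone_iff.mp he
  obtain ⟨c, hc, hsumc⟩ := D.mem_corootCone_iff.mp hzh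
  -- If `c k = 0`, the nonpositive off-diagonal entries give `α_k (h - z) ≤ 0`, contradicting `α_k z
  -- = 0 < α_k h`.
  have hcK : ∀ k ∈ K, 0 < c k := by
    intro k hk
    refine (hc k).lt_of_ne fun h0 => ?_
    have h1 : D.root k (h - z) ≤ 0 := by
      rw [hsumc, map_sum]
      refine Finset.sum_nonpos fun j _ => ?_
      rw [map_smul, root_coroot, smul_eq_mul]
      by_cases hjk : j = k
      · rw [hjk, ← h0, zero_mul]
      · exact mul_nonpos_of_nonneg_of_nonpos (hc j)
          (by exact_mod_cast D.isGCM.off_diag j k hjk)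
    rw [map_sub, show D.root k z = 0 from hk] at h1
    linarith [hh k]
  -- For small `ε > 0` the point `z + ε (h - a)` is strictly dominant and still below `h`; roots and
  -- coefficients in `K` and outside `K` are positive for different reasons.
  have hev : ∀ᶠ ε : ℝ in nhdsWithin 0 (Set.Ioi 0), ∀ k,
      0 < D.root k z + ε * D.root k (h - a) ∧ 0 ≤ c k - ε * e k := by
    rw [Filter.eventually_all]
    intro k
    refine Filter.Eventually.and ?_ ?_
    · by_cases hk : k ∈ K
      · filter_upwards [self_mem_nhdsWithin] with ε hε
        rw [map_sub, hroota k hk, sub_zero, show D.root k z = 0 from hk, zero_add]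
        exact mul_pos hε (hh k)
      · have hpos : 0 < D.root k z := (hz k).lt_of_ne (Ne.symm hk)
        have hcont : Continuous fun ε : ℝ => D.root k z + ε * D.root k (h - a) := by fun_prop
        exact (hcont.tendsto 0).mono_left nhdsWithin_le_nhds |>.eventually
          (lt_mem_nhds (by rwa [zero_mul, add_zero]))
    · by_cases hk : k ∈ K
      · have hcont : Continuous fun ε : ℝ => c k - ε * e k := by fun_prop
        filter_upwards [(hcont.tendsto 0).mono_left nhdsWithin_le_nhds |>.eventually
          (lt_mem_nhds (a := 0) (by rw [zero_mul, sub_zero]; exact hcK k hk))] with ε hε using hε.le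
      · filter_upwards with ε
        simpa [heK k hk] using hc k
  obtain ⟨ε, hε⟩ := hev.exists
  have hz' : z + ε • (h - a) ∈ D.orbitHull h := by
    refine D.mem_orbitHull_of_sub_mem_corootCone (fun k => ?_) hh ?_
    · rw [map_add, map_smul, smul_eq_mul]
      exact (hε k).1
    · refine D.mem_corootCone_iff.mpr ⟨fun k => c k - ε * e k, fun k => (hε k).2, ?_⟩
      simp_rw [sub_smul, Finset.sum_sub_distrib, ← hsumc, mul_smul, ← Finset.smul_sum, ← hsume]
      abel
  -- Since `W_K` fixes `z` and `a`, averaging the translates of the perturbed point over `W_K h`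
  -- recovers `z`.
  have hzavg : z = ∑ p ∈ O, (1 / n) • (z + ε • (p - a)) := by
    rw [← Finset.smul_sum, Finset.sum_add_distrib, ← Finset.smul_sum, Finset.sum_sub_distrib,
      Finset.sum_const, Finset.sum_const, ← Nat.cast_smul_eq_nsmul ℝ, ← Nat.cast_smul_eq_nsmul ℝ,
      ← hndef]
    have : ∑ p ∈ O, p = n • a := by
      rw [ha, smul_smul, mul_one_div_cancel hn.ne', one_smul]
    rw [this, sub_self, smul_zero, add_zero, smul_smul, one_div_mul_cancel hn.ne', one_smul]
  rw [hzavg]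
  refine (D.convex_orbitHull h).sum_mem (fun _ _ => one_div_nonneg.mpr hn.le)
    (by rw [Finset.sum_const, nsmul_eq_mul, mul_one_div_cancel hn.ne']) fun p hp => ?_
  rw [hmemO] at hp
  obtain ⟨w, hw, rfl⟩ := hp
  have h1 := D.weylAction_mem_orbitHull_of_mem hz' w
  rwa [map_add, map_smul, map_sub,
    D.weylAction_eq_self_of_mem_standardSubgroup (fun k hk => hk) hw,
    D.weylAction_eq_self_of_mem_standardSubgroup hroota hw] at h1

/-- A translate maximizing `ρ` is dominant, because reflecting it in `s_k` changes `ρ` by minus the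
value of `α_k`. -/
theorem exists_forall_root_weylAction_nonneg {y : RealCartan Λ}
    {ρ : Module.Dual ℝ (RealCartan Λ)} (hρ : ∀ k, ρ (D.coroot k) = 1)
    (hy : ∀ M, {w | M ≤ ρ (D.weylAction w y)}.Finite) :
    ∃ w, ∀ k, 0 ≤ D.root k (D.weylAction w y) := by
  obtain ⟨w, hw, hmax⟩ := Set.exists_max_image _ (fun w => ρ (D.weylAction w y)) (hy (ρ y))
    ⟨1, by simp⟩
  refine ⟨w, fun k => ?_⟩
  by_contra! hk
  have h1 : ρ (D.weylAction (D.cox.simple k * w) y) =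
      ρ (D.weylAction w y) - D.root k (D.weylAction w y) := by
    rw [weylAction_mul_apply, weylAction_simple_apply, map_sub, map_smul, hρ, smul_eq_mul, mul_one]
  have hw' : ρ y ≤ ρ (D.weylAction w y) := hw
  have h2 := hmax (D.cox.simple k * w) (by rw [Set.mem_ofPred_eq, h1]; linarith)
  linarith

/-- A point with finitely many not too low translates, all of which are below the strictly
dominant point `h`, lies in the hull of the orbit of `h`. -/
theorem mem_orbitHull_of_forall_finite [Fintype ι] {y h : RealCartan Λ}
    {ρ : Module.Dual ℝ (RealCartan Λ)} (hρ : ∀ k, ρ (D.coroot k) = 1)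
    (hy : ∀ M, {w | M ≤ ρ (D.weylAction w y)}.Finite) (hh : ∀ k, 0 < D.root k h)
    (hyh : ∀ w, h - D.weylAction w y ∈ D.corootCone) : y ∈ D.orbitHull h := by
  obtain ⟨w, hw⟩ := D.exists_forall_root_weylAction_nonneg hρ hy
  apply D.mem_orbitHull_of_weylAction_mem (w := w)
  refine D.mem_orbitHull_of_finite_orbit hw hh (hyh w) ?_
  -- Elements `g` fixing the dominant point `w y` give translates `g w y` of equal height, so there
  -- are finitely many of them.
  refine ((hy (ρ (D.weylAction w y))).image fun g => D.weylAction (g * w⁻¹) h).subset ?_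
  rintro _ ⟨g, hg, rfl⟩
  refine ⟨g * w, ?_, by simp⟩
  have := D.weylAction_eq_self_of_mem_standardSubgroup (fun k hk => hk) hg
  rw [Set.mem_ofPred_eq, weylAction_mul_apply, this]

theorem functional_le_of_sub_mem_corootCone [Fintype ι] {ρ : Module.Dual ℝ (RealCartan Λ)}
    (hρ : ∀ k, 0 ≤ ρ (D.coroot k)) {x y : RealCartan Λ} (hxy : y - x ∈ D.corootCone) :
    ρ x ≤ ρ y := by
  obtain ⟨c, hc, hsum⟩ := D.mem_corootCone_iff.mp hxy
  rw [← sub_nonneg, ← map_sub, hsum, map_sum]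
  exact Finset.sum_nonneg fun k _ => by
    rw [map_smul, smul_eq_mul]
    exact mul_nonneg (hc k) (hρ k)

/-- Translates of `z` never exceed the height of `h`, so a high translate of the combination needs a
high translate of `p`. -/
theorem finite_setOf_le_functional_combo [Fintype ι] {h p z : RealCartan Λ}
    {ρ : Module.Dual ℝ (RealCartan Λ)} (hρ : ∀ k, ρ (D.coroot k) = 1)
    (hh : ∀ k, 0 < D.root k h) (hp : ∀ k, 0 < D.root k p) (hz : z ∈ D.orbitHull h) {l : ℝ}
    (hl0 : 0 < l) (hl1 : l ≤ 1) (M : ℝ) :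
    {w | M ≤ ρ (D.weylAction w (l • p + (1 - l) • z))}.Finite := by
  refine (D.finite_setOf_le_functional hp hρ ((M - (1 - l) * ρ h) / l)).subset fun w hw => ?_
  have h1 : ρ (D.weylAction w z) ≤ ρ h :=
    D.functional_le_of_sub_mem_corootCone (fun k => by rw [hρ]; exact zero_le_one)
      (D.sub_mem_corootCone_of_mem_orbitHull (fun k => (hh k).le)
        (D.weylAction_mem_orbitHull_of_mem hz w))
  simp only [Set.mem_ofPred_eq, map_add, map_smul, smul_eq_mul] at hw ⊢
  rw [div_le_iff₀ hl0]
  nlinarith [mul_le_mul_of_nonneg_left h1 (sub_nonneg.mpr hl1)]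

theorem sub_weylAction_mem_span (w : D.WeylGroup) (x : RealCartan Λ) :
    x - D.weylAction w x ∈ Submodule.span ℝ (Set.range D.coroot) := by
  induction w using D.weylGroup_induction with
  | one => simp
  | step k w _ ih =>
    rw [weylAction_mul_apply, weylAction_simple_apply, sub_sub_eq_add_sub, add_sub_right_comm]
    exact add_mem ih (Submodule.smul_mem _ _ (Submodule.subset_span ⟨k, rfl⟩))

/-! ### Closedness of the orbit hull -/

/-- The orbit hull of a strictly dominant point is closed, in coordinates with respect to the
simple coroots. -/
theorem isClosed_setOf_mem_orbitHull [Fintype ι] [FiniteDimensional ℝ (RealCartan Λ)]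
    (hlin : LinearIndependent ℝ D.coroot) {h : RealCartan Λ} (hh : ∀ k, 0 < D.root k h) :
    IsClosed {n : ι → ℝ | h - ∑ k, n k • D.coroot k ∈ D.orbitHull h} := by
  classical
  set S := {n : ι → ℝ | h - ∑ k, n k • D.coroot k ∈ D.orbitHull h} with hS
  obtain ⟨T, hTdef⟩ : ∃ T, T = Fintype.linearCombination ℝ D.coroot := ⟨_, rfl⟩
  have hTapp : ∀ n : ι → ℝ, ∑ k, n k • D.coroot k = T n := fun n => by rw [hTdef]; rfl
  have hTrange : T.range = Submodule.span ℝ (Set.range D.coroot) := by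
    rw [hTdef, Fintype.range_linearCombination]
  simp_rw [hTapp] at hS
  have hTinj : T.ker = ⊥ := LinearMap.ker_eq_bot.mpr
    (hTdef ▸ linearIndependent_iff_injective_fintypeLinearCombination.mp hlin)
  obtain ⟨C, hC⟩ := T.exists_leftInverse_of_injective hTinj
  replace hC : ∀ n, C (T n) = n := fun n => LinearMap.congr_fun hC n
  have hcone : ∀ x, x ∈ D.corootCone → T (C x) = x ∧ ∀ k, 0 ≤ C x k := by
    intro x hx
    obtain ⟨c, hc, rfl⟩ := D.mem_corootCone_iff.mp hx
    rw [hTapp, hC]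
    exact ⟨rfl, hc⟩
  have hcont : ∀ φ : Module.Dual ℝ (RealCartan Λ), Continuous fun n => φ (T n) :=
    fun φ => (φ ∘ₗ T).continuous_of_finiteDimensional
  obtain ⟨ρ, hρ⟩ : ∃ ρ : Module.Dual ℝ (RealCartan Λ), ∀ k, ρ (D.coroot k) = 1 := by
    refine ⟨(∑ k, LinearMap.proj k) ∘ₗ C, fun k => ?_⟩
    have : D.coroot k = T (Pi.single k 1) := by
      simp [← hTapp, Pi.single_apply, ite_smul]
    simp [this, hC]
  have hρle : ∀ z ∈ D.orbitHull h, ρ z ≤ ρ h := fun z hz =>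
    D.functional_le_of_sub_mem_corootCone (fun k => by rw [hρ]; exact zero_le_one)
      (D.sub_mem_corootCone_of_mem_orbitHull (fun k => (hh k).le) hz)
  rw [← closure_subset_iff_isClosed]
  intro n₀ hn₀
  rw [hS, Set.mem_ofPred_eq]
  refine D.mem_orbitHull_of_forall_finite hρ ?_ hh ?_
  · set l : ℝ := 1 / (Module.finrank ℝ (RealCartan Λ) + 2) with hl
    have hl0 : 0 < l := by positivity
    have hl1 : l ≤ 1 := by
      rw [hl, div_le_one (by positivity)]
      linarith [(Nat.cast_nonneg (Module.finrank ℝ (RealCartan Λ)) : (0 : ℝ) ≤ _)]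
    -- `M` bounds the height of `h - T n` from below near `n₀`. As `ρ z ≤ ρ h`, the vertex `w h` of
    -- weight `l` then has height at least `(M - (1 - l) ρ h) / l`.
    set M := ρ h - ρ (T n₀) - 1
    have hF := D.finite_setOf_le_functional hh hρ ((M - (1 - l) * ρ h) / l)
    set F := {w | (M - (1 - l) * ρ h) / l ≤ ρ (D.weylAction w h)} with hFdef
    have hfreq : ∃ᶠ n in nhds n₀, n ∈ S := mem_closure_iff_frequently.mp hn₀
    have hnear : ∀ᶠ n in nhds n₀, ρ (T n) < ρ (T n₀) + 1 :=
      ((hcont ρ).tendsto n₀).eventually (gt_mem_nhds (by linarith))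
    have hfreq' : ∃ᶠ n in nhds n₀, ∃ w ∈ F, ∃ z ∈ D.orbitHull h,
        h - T n = l • D.weylAction w h + (1 - l) • z := by
      refine (hfreq.and_eventually hnear).mono ?_
      rintro n ⟨hn, hn'⟩
      obtain ⟨p, ⟨w, rfl⟩, z, hz, hnz⟩ :=
        exists_combo_of_mem_convexHull (show _ ∈ D.orbitHull h from hn)
      rw [hTapp, ← hl] at hnz
      refine ⟨w, ?_, z, hz, hnz⟩
      have h1 := congrArg ρ hnz
      simp only [map_add, map_sub, map_smul, smul_eq_mul] at h1
      have h2 := mul_le_mul_of_nonneg_left (hρle z hz) (sub_nonneg.mpr hl1)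
      rw [hFdef, Set.mem_ofPred_eq, div_le_iff₀ hl0]
      linarith
    -- Pigeonhole over the finite set `F`: a single `w` serves points arbitrarily close to the
    -- limit.
    obtain ⟨w, -, hw⟩ : ∃ w ∈ F, ∃ᶠ n in nhds n₀, ∃ z ∈ D.orbitHull h,
        h - T n = l • D.weylAction w h + (1 - l) • z := by
      by_contra! hcon
      refine hfreq' ?_
      filter_upwards [(Filter.eventually_all_finite hF).mpr hcon] with n hn
      rintro ⟨w, hw, z, hz, hwz⟩
      exact hn w hw z hz hwz
    -- The error `T n - T n₀` is absorbed into the vertex: after applying `w⁻¹` it becomes a small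
    -- perturbation of `h`, still strictly dominant.
    have hev : ∀ᶠ n in nhds n₀, ∀ k,
        0 < D.root k (h + l⁻¹ • D.weylAction w⁻¹ (T n - T n₀)) := by
      rw [Filter.eventually_all]
      intro k
      have hc := hcont (D.root k ∘ₗ (D.weylAction w⁻¹ : RealCartan Λ →ₗ[ℝ] RealCartan Λ))
      simp only [LinearMap.comp_apply, LinearEquiv.coe_coe] at hc
      have hc' : Continuous fun n => D.root k (h + l⁻¹ • D.weylAction w⁻¹ (T n - T n₀)) := by
        simp only [map_add, map_smul, map_sub, smul_eq_mul]
        fun_prop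
      exact (hc'.tendsto n₀).eventually (lt_mem_nhds (by simpa using hh k))
    obtain ⟨n, ⟨z, hz, hnz⟩, hn⟩ := (hw.and_eventually hev).exists
    intro M'
    have hfin := D.finite_setOf_le_functional_combo hρ hh hn
      (D.weylAction_mem_orbitHull_of_mem hz w⁻¹) hl0 hl1 M'
    have heq : l • (h + l⁻¹ • D.weylAction w⁻¹ (T n - T n₀)) + (1 - l) • D.weylAction w⁻¹ z =
        D.weylAction w⁻¹ (h - T n₀) := by
      have h1 : h - T n₀ = l • D.weylAction w h + (1 - l) • z + (T n - T n₀) := by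
        rw [← hnz]; abel
      rw [h1, map_add, map_add, map_smul, map_smul, weylAction_inv_apply_self, smul_add,
        smul_inv_smul₀ hl0.ne']
      abel
    rw [heq] at hfin
    refine (hfin.preimage (mul_left_injective w).injOn).subset fun v hv => ?_
    simpa [weylAction_mul_apply, weylAction_apply_inv_self] using hv
  · intro w
    have hrange : ∀ n, T (C (h - D.weylAction w (h - T n))) = h - D.weylAction w (h - T n) := by
      intro n
      have h1 : h - D.weylAction w (h - T n) ∈ T.range := by
        have h2 := add_mem (D.sub_weylAction_mem_span w (h - T n))
          (hTrange ▸ LinearMap.mem_range_self T n)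
        rw [← hTrange] at h2
        convert h2 using 1
        abel
      obtain ⟨m, hm⟩ := h1
      rw [← hm, hC]
    -- For fixed `w`, lying below `h` after translation by `w` is a closed condition on coordinates,
    -- so it passes to the limit.
    have hclosed : IsClosed {n | ∀ k, 0 ≤ C (h - D.weylAction w (h - T n)) k} := by
      simp only [Set.ofPred_forall]
      refine isClosed_iInter fun k => isClosed_le continuous_const ?_
      have hc := hcont (LinearMap.proj k ∘ₗ C ∘ₗ
        (D.weylAction w : RealCartan Λ →ₗ[ℝ] RealCartan Λ))
      convert hc.const_add (C (h - D.weylAction w h) k) using 2 with n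
      simp only [LinearMap.comp_apply, LinearEquiv.coe_coe, LinearMap.proj_apply]
      rw [← Pi.add_apply, ← map_add, map_sub (D.weylAction w)]
      exact congrArg (fun z => C z k) (by abel)
    have hsub : S ⊆ {n | ∀ k, 0 ≤ C (h - D.weylAction w (h - T n)) k} := by
      intro n hn
      rw [hS] at hn
      exact (hcone _ (D.sub_mem_corootCone_of_mem_orbitHull
        (fun k => (hh k).le) (D.weylAction_mem_orbitHull_of_mem hn w))).2
    exact D.mem_corootCone_iff.mpr
      ⟨_, closure_minimal hsub hclosed hn₀, by rw [hTapp, hrange]⟩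

end KacMoodyRootDatum

/-! ### The face generated by a point -/

/-- The points of a convex set `P` from which the segment to `y ∈ P` can be prolonged inside `P`
form a face of `P`. -/
theorem isFace_setOf_openSegment {V : Type*} [AddCommGroup V] [Module ℝ V] {P : Set V}
    (hP : Convex ℝ P) {y : V} (hy : y ∈ P) :
    IsFace P {z | z ∈ P ∧ ∃ z' ∈ P, y ∈ openSegment ℝ z z'} := by
  refine ⟨⟨y, hy, y, hy, by simp [openSegment_same]⟩, ?_, fun z hz => hz.1, ?_⟩
  · rintro z₁ ⟨h₁, z₁', h₁', a₁, b₁, ha₁, hb₁, hab₁, hy₁⟩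
      z₂ ⟨h₂, z₂', h₂', a₂, b₂, ha₂, hb₂, hab₂, hy₂⟩
      p q hp hq hpq
    have hd : 0 < p * a₂ + q * a₁ := by
      rcases hp.eq_or_lt with rfl | hp'
      · have : q = 1 := by linarith
        rw [this]; linarith
      · have := mul_pos hp' ha₂
        have := mul_nonneg hq ha₁.le
        linarith
    set d := p * a₂ + q * a₁
    have hr : 0 < p * a₂ * b₁ + q * a₁ * b₂ := by
      rcases hp.eq_or_lt with rfl | hp'
      · have : q = 1 := by linarith
        rw [this]; nlinarith [mul_pos ha₁ hb₂]
      · have := mul_pos (mul_pos hp' ha₂) hb₁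
        have := mul_nonneg (mul_nonneg hq ha₁.le) hb₂.le
        linarith
    set r := p * a₂ * b₁ + q * a₁ * b₂
    -- The two expressions for `y` are combined with weights `p a₂ / d` and `q a₁ / d`, so that `z₁`
    -- and `z₂` appear in the ratio `p : q`; the other terms form the new far endpoint.
    refine ⟨hP h₁ h₂ hp hq hpq, (p * a₂ * b₁ / r) • z₁' + (q * a₁ * b₂ / r) • z₂',
      hP h₁' h₂' (by positivity) (by positivity) (by rw [← add_div, div_self hr.ne']),
      a₁ * a₂ / d, r / d, by positivity, by positivity, ?_, ?_⟩
    · rw [← add_div, div_eq_one_iff_eq hd.ne']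
      simp only [r, d]
      rw [show b₁ = 1 - a₁ by linarith, show b₂ = 1 - a₂ by linarith, show q = 1 - p by linarith]
      ring
    · have h1 : (a₁ * a₂ / d) • (p • z₁ + q • z₂) +
          (r / d) • ((p * a₂ * b₁ / r) • z₁' + (q * a₁ * b₂ / r) • z₂') =
          (p * a₂ / d) • (a₁ • z₁ + b₁ • z₁') + (q * a₁ / d) • (a₂ • z₂ + b₂ • z₂') := by
        match_scalars <;> field_simp
      rw [h1, hy₁, hy₂, ← add_smul, ← add_div, div_self hd.ne', one_smul]
  · rintro x₁ h₁ x₂ h₂ z ⟨hz, z', hz', a, b, ha, hb, hab, hy'⟩ ⟨c, e, hc, he, hce, rfl⟩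
    have hr : 0 < a * e + b := by positivity
    refine ⟨h₁, (a * e / (a * e + b)) • x₂ + (b / (a * e + b)) • z',
      hP h₂ hz' (by positivity) (by positivity) (by rw [← add_div, div_self hr.ne']),
      a * c, a * e + b, by positivity, hr, ?_, ?_⟩
    · rw [← add_assoc, ← mul_add, hce, mul_one, hab]
    · rw [← hy']
      match_scalars <;> field_simp

/-! ### Lifting to the chamber, maximal points and the essential part -/

namespace KacMoodyRootDatum

variable {ι Λ : Type*} [AddCommGroup Λ] (D : KacMoodyRootDatum ι Λ)

/-- Every point of the orbit of a strictly dominant point has a conjugate under `W_J` in the open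
fundamental chamber of `W_J`. -/
theorem exists_standardSubgroup_openChamber [Finite ι] {h : RealCartan Λ}
    (hh : ∀ k, 0 < D.root k h) (J : Set ι) (w : D.WeylGroup) :
    ∃ u ∈ D.standardSubgroup J, D.weylAction (u * w) h ∈ D.openChamber J := by
  -- A shortest element `u w` of the coset `W_J w` has no left descent in `J`.
  obtain ⟨u, hu, hmin⟩ := (measure fun u => D.cox.length (u * w)).wf.has_min
    (D.standardSubgroup J : Set D.WeylGroup) ⟨1, one_mem _⟩
  refine ⟨u, hu, fun k hk => ?_⟩
  obtain ⟨ε, hε, hεh⟩ := D.exists_pos_forall_le_root hh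
  refine hε.trans_le (D.le_root_weylAction (fun hdesc => ?_) hε.le hεh)
  refine hmin (D.cox.simple k * u) (mul_mem (Subgroup.subset_closure ⟨k, hk, rfl⟩) hu) ?_
  change D.cox.length _ < D.cox.length _
  rw [mul_assoc]
  exact hdesc

/-- Every point of the orbit hull of a strictly dominant point lies in the hull of the `W_J`-orbit
of a point of the orbit hull in the open fundamental chamber of `W_J`. -/
theorem exists_openChamber_mem_orbitHull_restrict [Finite ι] {h : RealCartan Λ}
    (hh : ∀ k, 0 < D.root k h) (J : Set ι) {x : RealCartan Λ} (hx : x ∈ D.orbitHull h) :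
    ∃ p ∈ D.orbitHull h, p ∈ D.openChamber J ∧ x ∈ (D.restrict J).orbitHull p := by
  -- The points with the desired property form a convex set: combining the dominant points `p` and
  -- `q` works because hulls of dominant points add.
  suffices D.orbitHull h ⊆
      {x | ∃ p ∈ D.orbitHull h, p ∈ D.openChamber J ∧ x ∈ (D.restrict J).orbitHull p} from this hx
  refine convexHull_min ?_ ?_
  · rintro _ ⟨w, rfl⟩
    obtain ⟨u, hu, hC⟩ := D.exists_standardSubgroup_openChamber hh J w
    refine ⟨_, D.weylAction_mem_orbitHull h (u * w), hC, ?_⟩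
    rw [← convexHull_orbit]
    exact subset_convexHull ℝ _ ⟨u⁻¹, inv_mem hu, by
      rw [weylAction_mul_apply, weylAction_inv_apply_self]⟩
  · rintro x ⟨p, hp, hpC, hxp⟩ y ⟨q, hq, hqC, hyq⟩ a b ha hb hab
    refine ⟨a • p + b • q, D.convex_orbitHull h hp hq ha hb hab, fun k hk => ?_, ?_⟩
    · have h1 := hpC k hk
      have h2 := hqC k hk
      rw [map_add, map_smul, map_smul, smul_eq_mul, smul_eq_mul]
      rcases ha.eq_or_lt with rfl | ha'
      · have : b = 1 := by linarith
        rw [this]; linarith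
      · have := mul_pos ha' h1
        have := mul_nonneg hb h2.le
        linarith
    · refine (D.restrict J).add_mem_orbitHull (fun k => ?_) (fun k => ?_)
        ((D.restrict J).smul_mem_orbitHull a hxp) ((D.restrict J).smul_mem_orbitHull b hyq)
      · rw [map_smul]; exact mul_nonneg ha (hpC k k.2).le
      · rw [map_smul]; exact mul_nonneg hb (hqC k k.2).le

/-- Above every point of the orbit hull of a strictly dominant point there is a maximal point with
respect to the order defined by the coroots in `J`. -/
theorem exists_maximal_mem_orbitHull [Fintype ι] [FiniteDimensional ℝ (RealCartan Λ)]
    (hlin : LinearIndependent ℝ D.coroot) {h : RealCartan Λ} (hh : ∀ k, 0 < D.root k h)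
    (J : Set ι) {p : RealCartan Λ} (hp : p ∈ D.orbitHull h) :
    ∃ y ∈ D.orbitHull h, y - p ∈ (D.restrict J).corootCone ∧
      ∀ y' ∈ D.orbitHull h, y' - y ∈ (D.restrict J).corootCone → y' = y := by
  have hexp : ∀ z ∈ D.orbitHull h, ∃ n : ι → ℝ, 0 ≤ n ∧ z = h - ∑ k, n k • D.coroot k := by
    intro z hz
    obtain ⟨n, hn, hsum⟩ := D.mem_corootCone_iff.mp
      (D.sub_mem_corootCone_of_mem_orbitHull (fun k => (hh k).le) hz)
    exact ⟨n, hn, by rw [← hsum, sub_sub_cancel]⟩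
  have hinj : ∀ m n : ι → ℝ, ∑ k, m k • D.coroot k = ∑ k, n k • D.coroot k → m = n :=
    fun m n hmn => linearIndependent_iff_injective_fintypeLinearCombination.mp hlin hmn
  obtain ⟨m, hm, rfl⟩ := hexp p hp
  -- In the coordinates of `h - z`, going up in the `J`-order lowers coordinates in `J` and fixes
  -- the others. The candidates above `p` thus form a compact set, and a minimal coordinate sum
  -- gives a maximal point.
  set K : Set (ι → ℝ) := Set.Icc 0 m ∩ ({n | h - ∑ k, n k • D.coroot k ∈ D.orbitHull h} ∩
    {n | ∀ k ∉ J, n k = m k})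
  have hclosed : IsClosed {n : ι → ℝ | ∀ k ∉ J, n k = m k} := by
    simp only [Set.ofPred_forall]
    exact isClosed_iInter fun k => isClosed_iInter fun _ =>
      isClosed_eq (continuous_apply k) continuous_const
  have hcomp : IsCompact K :=
    isCompact_Icc.inter_right ((D.isClosed_setOf_mem_orbitHull hlin hh).inter hclosed)
  obtain ⟨n, hnK, hmin⟩ := hcomp.exists_isMinOn (f := fun n => ∑ k, n k)
    ⟨m, ⟨hm, le_rfl⟩, hp, fun _ _ => rfl⟩
    (continuous_finsetSum _ fun k _ => continuous_apply k).continuousOn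
  obtain ⟨⟨hn0, hnm⟩, hnH, hnJ⟩ := hnK
  refine ⟨_, hnH, ?_, ?_⟩
  · refine D.mem_restrict_corootCone_iff.mpr ⟨fun k => m k - n k, fun k => sub_nonneg.mpr (hnm k),
      fun k hk => sub_eq_zero.mpr (hnJ k hk).symm, ?_⟩
    simp_rw [sub_smul, Finset.sum_sub_distrib]
    abel
  · intro y' hy' hcone
    obtain ⟨n', hn'0, rfl⟩ := hexp y' hy'
    obtain ⟨c, hc, hcJ, hsum⟩ := D.mem_restrict_corootCone_iff.mp hcone
    have hn' : n' = n - c := by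
      apply hinj
      simp only [Pi.sub_apply, sub_smul, Finset.sum_sub_distrib]
      rw [← hsum]
      abel
    have hle : ∑ k, n k ≤ ∑ k, n' k := hmin ⟨⟨hn'0, fun k => ?_⟩, hy', fun k hk => ?_⟩
    · have hc0 : ∀ k, c k = 0 := by
        have h1 : ∑ k, c k ≤ 0 := by
          simp only [hn', Pi.sub_apply, Finset.sum_sub_distrib] at hle
          linarith
        intro k
        exact (Finset.sum_eq_zero_iff_of_nonneg fun k _ => hc k).mp
          (h1.antisymm (Finset.sum_nonneg fun k _ => hc k)) k (Finset.mem_univ k)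
      have : n' = n := by
        rw [hn']
        ext k
        simp [hc0 k]
      rw [this]
    · rw [hn']
      have := hnm k
      have := hc k
      simp only [Pi.sub_apply]
      linarith
    · rw [hn', Pi.sub_apply, hcJ k hk, sub_zero, hnJ k hk]

theorem eq_of_sub_mem_corootCone [Fintype ι] (hlin : LinearIndependent ℝ D.coroot)
    {x : RealCartan Λ} (hx : x ∈ D.corootCone) (hx' : -x ∈ D.corootCone) : x = 0 := by
  obtain ⟨c, hc, rfl⟩ := D.mem_corootCone_iff.mp hx
  obtain ⟨e, he, hsum⟩ := D.mem_corootCone_iff.mp hx'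
  have h1 : ∑ k, (c k + e k) • D.coroot k = 0 := by
    simp_rw [add_smul, Finset.sum_add_distrib, ← hsum, add_neg_cancel]
  have h2 := Fintype.linearIndependent_iff.mp hlin _ h1
  refine Finset.sum_eq_zero fun k _ => ?_
  have : c k = 0 := by linarith [h2 k, hc k, he k]
  rw [this, zero_smul]

theorem functional_eq_of_mem_orbitHull_restrict {J : Set ι} {ω : Module.Dual ℝ (RealCartan Λ)}
    (hω : ∀ k ∈ J, ω (D.coroot k) = 0) {x y : RealCartan Λ}
    (hxy : y - x ∈ (D.restrict J).corootCone) : ω x = ω y := by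
  have h1 : ω (y - x) = 0 := by
    refine Submodule.span_induction (p := fun z _ => ω z = 0) ?_ (map_zero ω) ?_ ?_ hxy
    · rintro _ ⟨k, rfl⟩
      exact hω k k.2
    · intro a b _ _ ha hb
      rw [map_add, ha, hb, add_zero]
    · intro a b _ hb
      change ω ((a : ℝ) • b) = 0
      rw [map_smul, hb, smul_zero]
  rw [map_sub] at h1
  linarith

/-- Membership in `E_h` is automatic, as `h - y` lies in the coroot cone. -/
theorem mem_slice_iff {h : RealCartan Λ} (hh : ∀ k, 0 < D.root k h)
    {ω : Module.Dual ℝ (RealCartan Λ)} {t : ℝ} {y : RealCartan Λ} :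
    y ∈ D.slice h ω t ↔ y ∈ D.orbitHull h ∧ ω y = t := by
  refine ⟨fun hy => ⟨hy.1, hy.2.2⟩, fun hy => ⟨hy.1, ?_, hy.2⟩⟩
  have h1 := D.sub_mem_corootCone_of_mem_orbitHull (fun k => (hh k).le) hy.1
  have h2 : h - y ∈ Submodule.span ℝ (Set.range D.coroot) :=
    Submodule.span_le_restrictScalars {c : ℝ // 0 ≤ c} ℝ _ h1
  have h3 := neg_mem h2
  rwa [neg_sub] at h3

theorem convex_slice {h : RealCartan Λ} (hh : ∀ k, 0 < D.root k h)
    {ω : Module.Dual ℝ (RealCartan Λ)} {t : ℝ} : Convex ℝ (D.slice h ω t) := by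
  intro x hx y hy a b ha hb hab
  rw [D.mem_slice_iff hh] at hx hy ⊢
  refine ⟨D.convex_orbitHull h hx.1 hy.1 ha hb hab, ?_⟩
  rw [map_add, map_smul, map_smul, hx.2, hy.2, ← add_smul, hab, one_smul]

/-- A point of a slice that is maximal with respect to the order defined by the coroots in `J`
belongs to the essential part of the slice. -/
theorem mem_essentialPart_of_maximal [Fintype ι] (hlin : LinearIndependent ℝ D.coroot)
    {h : RealCartan Λ} (hh : ∀ k, 0 < D.root k h) {J : Set ι}
    {ω : Module.Dual ℝ (RealCartan Λ)} {t : ℝ} {y : RealCartan Λ} (hy : y ∈ D.slice h ω t)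
    (hmax : ∀ y' ∈ D.orbitHull h, y' - y ∈ (D.restrict J).corootCone → y' = y) :
    y ∈ D.essentialPart J (D.slice h ω t) := by
  refine ⟨_, isFace_setOf_openSegment (D.convex_slice hh) hy, ?_, hy, y, hy,
    by simp [openSegment_same]⟩
  classical
  rintro z ⟨hz, z', hz', a, b, ha, hb, hab, hyz⟩
  have hup : ∀ z ∈ D.slice h ω t, ∃ p ∈ D.orbitHull h, p ∈ D.openChamber J ∧
      p - z ∈ (D.restrict J).corootCone := by
    intro z hz
    obtain ⟨p, hp, hpC, hzp⟩ := D.exists_openChamber_mem_orbitHull_restrict hh J hz.1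
    exact ⟨p, hp, hpC,
      (D.restrict J).sub_mem_corootCone_of_mem_orbitHull (fun k => (hpC k k.2).le) hzp⟩
  obtain ⟨p, hp, hpC, hzp⟩ := hup z hz
  obtain ⟨p', hp', -, hzp'⟩ := hup z' hz'
  -- By maximality of `y` the left side vanishes, so two elements of a pointed cone sum to zero;
  -- hence `p = z`.
  have heq : a • p + b • p' - y = a • (p - z) + b • (p' - z') := by
    rw [← hyz]; module
  have h1 := (D.restrict J).smul_mem_corootCone ha.le hzp
  have h2 := (D.restrict J).smul_mem_corootCone hb.le hzp'
  have h3 := hmax _ (D.convex_orbitHull h hp hp' ha.le hb.le hab) (by rw [heq]; exact add_mem h1 h2)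
  rw [h3, sub_self] at heq
  have hlinJ : LinearIndependent ℝ (D.restrict J).coroot :=
    hlin.comp _ Subtype.val_injective
  have h4 : a • (p - z) = 0 := by
    refine (D.restrict J).eq_of_sub_mem_corootCone hlinJ h1 ?_
    rw [neg_eq_of_add_eq_zero_right heq.symm]
    exact h2
  rw [smul_eq_zero_iff_right ha.ne', sub_eq_zero] at h4
  rwa [← h4]

end KacMoodyRootDatum

theorem mainTheorem7 {ι Λ κ : Type*} [Fintype ι] [DecidableEq ι] [AddCommGroup Λ]
    [Module.Free ℤ Λ] [Module.Finite ℤ Λ] (D : KacMoodyRootDatum ι Λ)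
    (hsymm : IsSymmetrizable D.A) (hfree : D.IsFree) (hcofree : D.IsCofree)
    (b : Module.Basis (ι ⊕ κ) ℝ (RealCartan Λ)) (hb : ∀ j, b (Sum.inl j) = D.coroot j)
    (h : RealCartan Λ) (hh : h ∈ D.openChamber Set.univ) (i : ι) (t : ℝ) :
    D.slice h (b.coord (Sum.inl i)) t =
      ⋃ y ∈ D.essentialPart {i}ᶜ (D.slice h (b.coord (Sum.inl i)) t),
        convexHull ℝ (D.orbit {i}ᶜ y) := by
  classical
  have hh' : ∀ k, 0 < D.root k h := fun k => hh k (Set.mem_univ k)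
  have hlin : LinearIndependent ℝ D.coroot := by
    have := b.linearIndependent.comp _ (Sum.inl_injective (α := ι) (β := κ))
    rwa [show b ∘ Sum.inl = D.coroot from funext hb] at this
  have hω : ∀ k ∈ ({i}ᶜ : Set ι), b.coord (Sum.inl i) (D.coroot k) = 0 := by
    intro k hk
    rw [← hb, Module.Basis.coord_apply, Module.Basis.repr_self, Finsupp.single_apply, if_neg]
    intro hki
    exact hk (Sum.inl_injective hki)
  set J : Set ι := {i}ᶜ
  set ω := b.coord (Sum.inl i)
  simp_rw [D.convexHull_orbit]
  ext x
  simp only [Set.mem_iUnion, exists_prop]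
  constructor
  · intro hx
    obtain ⟨p, hp, hpC, hxp⟩ := D.exists_openChamber_mem_orbitHull_restrict hh' J hx.1
    have hxp' := (D.restrict J).sub_mem_corootCone_of_mem_orbitHull (fun k => (hpC k k.2).le) hxp
    obtain ⟨y, hy, hpy, hmax⟩ := D.exists_maximal_mem_orbitHull hlin hh' J hp
    have hyt : ω y = t := by
      rw [← D.functional_eq_of_mem_orbitHull_restrict hω hpy,
        ← D.functional_eq_of_mem_orbitHull_restrict hω hxp']
      exact hx.2.2
    have hess := D.mem_essentialPart_of_maximal hlin hh' ((D.mem_slice_iff hh').mpr ⟨hy, hyt⟩) hmax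
    refine ⟨y, hess, (D.restrict J).orbitHull_subset ?_ hxp⟩
    obtain ⟨F, -, hFC, hyF⟩ := hess
    -- Membership of `y` in the essential part supplies its strict dominance for `J`.
    exact (D.restrict J).mem_orbitHull_of_sub_mem_corootCone (fun k => hpC k k.2)
      (fun k => hFC hyF k k.2) hpy
  · rintro ⟨y, ⟨F, hF, hFC, hyF⟩, hxy⟩
    have hy := hF.2.2.subset hyF
    have hxy' := (D.restrict J).sub_mem_corootCone_of_mem_orbitHull
      (fun k => (hFC hyF k k.2).le) hxy
    refine (D.mem_slice_iff hh').mpr ⟨?_, ?_⟩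
    · rw [← D.convexHull_orbit] at hxy
      refine convexHull_min ?_ (D.convex_orbitHull h) hxy
      rintro _ ⟨w, -, rfl⟩
      exact D.weylAction_mem_orbitHull_of_mem hy.1 w
    · rw [D.functional_eq_of_mem_orbitHull_restrict hω hxy']
      exact hy.2.2
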